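/- **Theorem (integral reward probabilities).** A reward-mixing Markov decision process (RMMDP) with finite nonempty state space $\mathcal S$ ($|\mathcal S|=S$), finite nonempty action space $\mathcal A$ ($|\mathcal A|=A$), finite set of reward values $\mathcal Z\subset[-1,1]$ and $M$ latent contexts consists of a transition kernel $T(s'\mid s,a)$, an initial distribution $\nu$, mixing weights $w_1,\dots,w_M\ge 0$ with $\sum_m w_m=1$, and, for each $m\in\{1,\dots,M\}$, reward probabilities $\mu_m(s,a,z)=\mathbb P(r=z\mid m,s,a)$ with $\sum_{z\in\mathcal Z}\mu_m(s,a,z)=1$. In each episode of length $H$ a context $m$ is drawn with probability $w_m$ and is not revealed; then $s_1\sim\nu$, $r_t\sim\mu_m(s_t,a_t,\cdot)$ and $s_{t+1}\sim T(\cdot\mid s_t,a_t)$. A history-dependent policy is a map $\pi:(\mathcal S\times\mathcal A\times\mathcal Z)^*\times\mathcal S\to\mathcal A$, its value is $V^\pi=\mathbb E_\pi[\sum_{t=1}^H r_t]$, and $\pi$ is $\epsilon$-optimal if $V^\pi\ge\sup_{\pi'}V^{\pi'}-\epsilon$, the supremum being over all history-dependent policies. There is a universal constant $C>0$, and for every integer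 $P\ge1$ there are nonnegative integers $c,a,b$ depending only on $P$, such that the following holds for all $\mathcal S,\mathcal A,\mathcal Z$ as above, all integers $M\ge2$ and $H>2P\log M$ ($\log$ is the natural logarithm), all $\epsilon,\eta\in(0,1)$ and, with $d=\lceil 2P\log M\rceil$, all nonnegative integers $K$ with $$K\;\ge\; C\cdot\frac{(SA)^{d}}{\epsilon^{2}}\cdot M^{cM}\cdot H^{a}\cdot\bigl(1+\log(K/\eta)\bigr)^{b}$$ (with the convention $\log 0=0$, so that $K=0$ never satisfies this condition). There exists a learning algorithm, which may depend on $\mathcal S,\mathcal A,\mathcal Z,M,H,P,\epsilon,\eta,K$ but not on $T,\nu,w,\mu$, that interacts with the unknown RMMDP for at most $K$ episodes, in each episode executing a history-dependent policy chosen from the trajectories observed in the previous episodes, and then outputs a history-dependent policy; for every RMMDP with these $\mathcal S,\mathcal A,\mathcal Z,M,H$ all of whose reward probabilities $\mu_m(s,a,z)$ lie in $\{0,1/P,2/P,\dots,1\}$, the output policy is $\epsilon$-optimal with probability at least $1-\eta$. (Deterministic rewards given the context are the case $P=1$.) -/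

import Mathlib

/-- A reward-mixing Markov decision process with finite state space `S`, finite action space `A`,
finite set of reward values `Z ⊆ ℝ` and `M` latent contexts: a common transition kernel `T` and
initial distribution `ν`, mixing weights `w`, and for each context `m` a conditional reward
distribution `μ m s a` on `Z`. -/
structure RMMDP (S A : Type*) [Fintype S] [Fintype A] (Z : Finset ℝ) (M : ℕ) where
  T : S → A → S → ℝ
  ν : S → ℝ
  w : Fin M → ℝ
  μ : Fin M → S → A → Z → ℝ
  T_nonneg : ∀ s a s', 0 ≤ T s a s'
  T_sum : ∀ s a, ∑ s', T s a s' = 1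
  ν_nonneg : ∀ s, 0 ≤ ν s
  ν_sum : ∑ s, ν s = 1
  w_nonneg : ∀ m, 0 ≤ w m
  w_sum : ∑ m, w m = 1
  μ_nonneg : ∀ m s a z, 0 ≤ μ m s a z
  μ_sum : ∀ m s a, ∑ z, μ m s a z = 1

namespace RMMDP

/-- A trajectory of length `H`: the state, action and reward at each of the `H` time steps. -/
abbrev Trajectory (S A : Type*) (Z : Finset ℝ) (H : ℕ) : Type _ := Fin H → S × A × Z

/-- History-dependent policies `(S × A × Z)^* × S → A`: the action is a function of the
past states, actions and rewards of the episode and of the current state. -/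
abbrev Policy (S A : Type*) (Z : Finset ℝ) : Type _ := List (S × A × Z) → S → A

/-- The states, actions and rewards of `τ` strictly before time `t`. -/
def past {S A : Type*} {Z : Finset ℝ} {H : ℕ} (τ : Trajectory S A Z H) (t : Fin H) :
    List (S × A × Z) :=
  (List.ofFn τ).take t

section

variable {S A : Type*} [Fintype S] [Fintype A] {Z : Finset ℝ} {M H : ℕ}

/-- The probability that the `t`-th state of `τ` follows what precedes it: `ν(s)` at the first time
step and `T(s_t | s_{t-1}, a_{t-1})` afterwards. -/
noncomputable def stateProb (𝓜 : RMMDP S A Z M) (τ : Trajectory S A Z H) (t : Fin H) : ℝ :=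
  if (t : ℕ) = 0 then 𝓜.ν (τ t).1
  else
    let p : Fin H := ⟨t - 1, lt_of_le_of_lt (Nat.sub_le _ _) t.isLt⟩
    𝓜.T (τ p).1 (τ p).2.1 (τ t).1

/-- The probability of a reward sequence given the state-action sequence: the latent context is
drawn once per episode, and is never observed. -/
noncomputable def rewardProb (𝓜 : RMMDP S A Z M) (τ : Trajectory S A Z H) : ℝ :=
  ∑ m, 𝓜.w m * ∏ t, 𝓜.μ m (τ t).1 (τ t).2.1 (τ t).2.2

open Classical in
/-- The probability of the trajectory `τ` when the policy `π` is executed for one episode. -/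
noncomputable def trajProb (𝓜 : RMMDP S A Z M) (π : Policy S A Z) (τ : Trajectory S A Z H) : ℝ :=
  (∏ t, 𝓜.stateProb τ t) * (∏ t, if (τ t).2.1 = π (past τ t) (τ t).1 then 1 else 0) *
    𝓜.rewardProb τ

/-- The expected cumulative reward of the policy `π` over an episode of length `H`. -/
noncomputable def value (𝓜 : RMMDP S A Z M) (H : ℕ) (π : Policy S A Z) : ℝ :=
  ∑ τ : Trajectory S A Z H, 𝓜.trajProb π τ * ∑ t, ((τ t).2.2 : ℝ)

/-- The optimal value over all history-dependent policies. -/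
noncomputable def optimalValue (𝓜 : RMMDP S A Z M) (H : ℕ) : ℝ :=
  ⨆ π : Policy S A Z, 𝓜.value H π

/-- The policy `π` is `ε`-optimal. -/
def IsEpsOptimal (𝓜 : RMMDP S A Z M) (H : ℕ) (ε : ℝ) (π : Policy S A Z) : Prop :=
  𝓜.optimalValue H - ε ≤ 𝓜.value H π

/-- All reward probabilities lie in `{0, 1/P, 2/P, …, 1}`. -/
def HasIntegralRewards (𝓜 : RMMDP S A Z M) (P : ℕ) : Prop :=
  ∀ m s a z, ∃ j : ℕ, j ≤ P ∧ 𝓜.μ m s a z = (j : ℝ) / P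

end

/-- An episodic learning algorithm: before each episode it selects, from the observed trajectories
of the previous episodes, the history-dependent policy to execute in that episode; at the end it
outputs a history-dependent policy computed from all observed trajectories. -/
structure LearningAlgorithm (S A : Type*) (Z : Finset ℝ) (H : ℕ) where
  explore : List (Trajectory S A Z H) → Policy S A Z
  output : List (Trajectory S A Z H) → Policy S A Z

namespace LearningAlgorithm

variable {S A : Type*} [Fintype S] [Fintype A] {Z : Finset ℝ} {M H : ℕ}

/-- The probability that the first `N` episodes of the algorithm in the model `𝓜` produce the
trajectories `D 0, …, D (N - 1)`. -/
noncomputable def dataProb (alg : LearningAlgorithm S A Z H) (𝓜 : RMMDP S A Z M) {N : ℕ}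
    (D : Fin N → Trajectory S A Z H) : ℝ :=
  ∏ k : Fin N, 𝓜.trajProb (alg.explore ((List.ofFn D).take k)) (D k)

open Classical in
/-- The probability that the policy output after `N` episodes in the model `𝓜` is `ε`-optimal. -/
noncomputable def successProb (alg : LearningAlgorithm S A Z H) (𝓜 : RMMDP S A Z M) (N : ℕ)
    (ε : ℝ) : ℝ :=
  ∑ D : Fin N → Trajectory S A Z H,
    if 𝓜.IsEpsOptimal H ε (alg.output (List.ofFn D)) then alg.dataProb 𝓜 D else 0

end LearningAlgorithm

end RMMDP

set_option linter.unusedSectionVars false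

/-! The algorithm never has to identify the latent contexts. It suffices to know, for every
`d`-tuple of state-action pairs with `d = ⌈2P log M⌉`, the joint law of the rewards seen there:
these moments of order `d` control the law of all `H` rewards.

The reason is a rigidity of grids. The difference of two reward laws is a signed combination of `2M`
products of numbers from `{0, 1/P, …, 1}`. If all its sub-products of degree at most `d` vanish, so
does the full one: subtracting the most popular value of a coordinate kills a fraction `1/(P+1)` of
the points at the cost of one degree, and `M < (1 + 1/P)^d` (`sum_mul_prod_eq_zero_of_low_degree`).
Integrality and Cramer's rule make this quantitative with a constant `M^{O(M)}` for fixed `P`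
(`abs_sum_mul_prod_le`). The bound is proportional to the likelihoods themselves, so summing it over
trajectories gives expectations of an uncertainty under genuine trajectory laws.

Learning is then reward-free optimism. Exploration policies ignore rewards, so given the visited
pairs the rewards have their unconditional law and empirical moments are unbiased. A model is
consistent if its transitions and moments fit the data up to martingale fluctuations; the true model
is so with high probability (`seqMeas_not_consistent_le`). The values of two consistent models
differ by at most a multiple of the optimistic exploration value (`abs_value_sub_le`). Greedy
exploration collects a constant fraction of that value (`planVal_le_sum_seqProb`), while the total
collected is `O(√K)` by pigeonhole over `(SA)^d` tuples (`sum_explorationReward_le`). Hence after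
some episode the exploration value is small, and a near-optimal policy of any model consistent with
that prefix is near-optimal for the truth (`one_sub_le_successProb`). -/

/-! ### Low-degree moments of grid-valued points. -/

/-- Products of grid values: a signed combination of few points of a grid with `P + 1` values per
coordinate whose multilinear moments of degree at most `d` vanish has no multilinear moments. -/
theorem sum_mul_prod_eq_zero_of_low_degree {ι κ : Type*} [DecidableEq ι] [DecidableEq κ]
    (v : ι → κ → ℝ) (vals : Finset ℝ) (P : ℕ) (hvals : vals.card ≤ P + 1)
    (hv : ∀ i t, v i t ∈ vals) (F : Finset κ) :
    ∀ (d : ℕ) (I : Finset ι) (c : ι → ℝ), I.card * P ^ d < 2 * (P + 1) ^ d →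
      (∀ T ⊆ F, T.card ≤ d → ∑ i ∈ I, c i * ∏ t ∈ T, v i t = 0) →
      ∑ i ∈ I, c i * ∏ t ∈ F, v i t = 0 := by
  induction F using Finset.induction_on with
  | empty =>
    intro d I c _ h
    exact h ∅ (Finset.Subset.refl _) (by simp)
  | insert t F ht ih =>
    intro d I c hI h
    rcases I.eq_empty_or_nonempty with rfl | hne
    · simp
    cases d with
    | zero =>
      -- In degree `0` the cardinality condition leaves a single point, and the empty product forces
      -- its coefficient to vanish.
      have hcard : I.card = 1 := by
        have := hne.card_pos
        simp at hI
        omega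
      obtain ⟨i, rfl⟩ := Finset.card_eq_one.1 hcard
      have := h ∅ (by simp) (by simp)
      simp at this
      simp [this]
    | succ d =>
      obtain ⟨i₀, hi₀⟩ := hne
      obtain ⟨v₀, -, hv₀⟩ := Finset.exists_le_card_fiber_of_nsmul_le_card_of_maps_to
        (s := I) (t := vals) (f := fun i => v i t) (b := (I.card : ℝ) / (P + 1))
        (fun i _ => hv i t) ⟨_, hv i₀ t⟩ (by
          rw [nsmul_eq_mul, mul_div_assoc', div_le_iff₀ (by positivity), mul_comm]
          gcongr
          exact_mod_cast hvals)
      -- `v₀` is a most popular value of coordinate `t`. The weights `c i * (v i t - v₀)` live on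
      -- `J`, whose size shrinks by the factor `P / (P + 1)` while one degree is spent: exactly the
      -- trade that preserves the cardinality condition.
      set J := I.filter (fun i => ¬ v i t = v₀) with hJ
      have hsplit := Finset.card_filter_add_card_filter_not (s := I) (fun i => v i t = v₀)
      have hJcard : J.card * (P + 1) ≤ I.card * P := by
        rw [div_le_iff₀ (by positivity)] at hv₀
        have h1 : I.card ≤ (I.filter (fun i => v i t = v₀)).card * (P + 1) := by
          exact_mod_cast hv₀
        nlinarith
      have hlow : ∀ T ⊆ F, T.card ≤ d + 1 → ∑ i ∈ I, c i * ∏ t ∈ T, v i t = 0 :=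
        fun T hT hc => h T (hT.trans (Finset.subset_insert _ _)) hc
      have h1 := ih (d + 1) I c hI hlow
      have h2 := ih d J (fun i => c i * (v i t - v₀)) (by
        have h3 : J.card * P ^ d * (P + 1) ≤ I.card * P ^ (d + 1) := by
          calc J.card * P ^ d * (P + 1) = J.card * (P + 1) * P ^ d := by ring
            _ ≤ I.card * P * P ^ d := by gcongr
            _ = _ := by ring
        have h4 : J.card * P ^ d * (P + 1) < 2 * (P + 1) ^ d * (P + 1) := by
          calc _ ≤ _ := h3
            _ < _ := hI
            _ = _ := by ring
        exact lt_of_mul_lt_mul_right h4 (Nat.zero_le _)) (by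
        intro T hT hc
        have htT : t ∉ T := fun h => ht (hT h)
        have e1 := h (insert t T) (Finset.insert_subset_insert _ hT)
          (by rw [Finset.card_insert_of_notMem htT]; omega)
        have e2 := hlow T hT (by omega)
        simp_rw [Finset.prod_insert htT] at e1
        rw [hJ, Finset.sum_filter_of_ne (p := fun i => ¬ v i t = v₀)]
        · calc ∑ i ∈ I, c i * (v i t - v₀) * ∏ t ∈ T, v i t
              = ∑ i ∈ I, c i * (v i t * ∏ t ∈ T, v i t)
                - v₀ * ∑ i ∈ I, c i * ∏ t ∈ T, v i t := by
                rw [Finset.mul_sum, ← Finset.sum_sub_distrib]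
                exact Finset.sum_congr rfl fun i _ => by ring
            _ = 0 := by rw [e1, e2]; ring
        · intro i _ hne heq
          exact hne (by rw [heq]; ring))
      rw [hJ, Finset.sum_filter_of_ne (p := fun i => ¬ v i t = v₀)] at h2
      · simp_rw [Finset.prod_insert ht]
        calc ∑ i ∈ I, c i * (v i t * ∏ t ∈ F, v i t)
            = ∑ i ∈ I, c i * (v i t - v₀) * ∏ t ∈ F, v i t
              + v₀ * ∑ i ∈ I, c i * ∏ t ∈ F, v i t := by
              rw [Finset.mul_sum, ← Finset.sum_add_distrib]
              exact Finset.sum_congr rfl fun i _ => by ring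
          _ = 0 := by rw [h1, h2]; ring
      · intro i _ hne heq
        exact hne (by rw [heq]; ring)

/-- The determinant bound of Cramer's rule, for an integral matrix with bounded entries. -/
theorem exists_coeff_of_integral_matrix {κ : Type*} [Fintype κ] [DecidableEq κ]
    (A : Matrix κ κ ℝ) (hA : IsUnit A) (q : ℝ) (hq : 1 ≤ q)
    (hint : ∀ i j, ∃ z : ℤ, A i j = z) (hbd : ∀ i j, |A i j| ≤ q)
    (b : κ → ℝ) (β : ℝ) (hβ : 0 ≤ β) (hb : ∀ i, |b i| ≤ β) (x : κ → ℝ)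
    (hx : A.mulVec x = b) (i : κ) :
    |x i| ≤ (Fintype.card κ).factorial * q ^ Fintype.card κ * β := by
  choose z hz using hint
  -- A nonzero integer determinant has absolute value at least `1`, so the denominator in Cramer's
  -- rule costs nothing.
  have hdet : 1 ≤ |A.det| := by
    have h0 : A.det ≠ 0 := by
      have := (Matrix.isUnit_iff_isUnit_det A).1 hA
      exact this.ne_zero
    have h1 : A.det = ((Matrix.of z).det : ℤ) := by
      have : A = (Matrix.of z).map (Int.castRingHom ℝ) := by
        ext i j; simp [hz]
      rw [this, ← RingHom.mapMatrix_apply, ← RingHom.map_det]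
      simp
    rw [h1] at h0 ⊢
    have h2 : (Matrix.of z).det ≠ 0 := by exact_mod_cast h0
    exact_mod_cast Int.one_le_abs h2
  rcases hβ.eq_or_lt with rfl | hβ
  · have hb0 : b = 0 := by
      ext j; simpa using hb j
    have : x = 0 := by
      have h := congrArg (A⁻¹).mulVec hx
      rw [Matrix.mulVec_mulVec, Matrix.nonsing_inv_mul _ ((Matrix.isUnit_iff_isUnit_det A).1 hA),
        hb0] at h
      simpa using h
    simp [this]
  -- After normalization the replaced column also has entries at most `1 ≤ q`, so one determinant
  -- bound covers the whole matrix.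
  set b' : κ → ℝ := fun i => b i / β
  have hcr : A.det * x i = β * A.cramer b' i := by
    have h1 : A.cramer b = A.det • x := by
      have := Matrix.cramer_eq_adjugate_mulVec A b
      rw [this, ← hx, Matrix.mulVec_mulVec, Matrix.adjugate_mul, Matrix.smul_mulVec,
        Matrix.one_mulVec]
    have h2 : b = β • b' := by
      ext j; simp [b']; field_simp
    have h3 := congrFun h1 i
    rw [h2, map_smul] at h3
    simpa using h3.symm
  have hc : |A.cramer b' i| ≤ (Fintype.card κ).factorial * q ^ Fintype.card κ := by
    rw [Matrix.cramer_apply]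
    have := Matrix.det_le (A := A.updateCol i b') (abv := AbsoluteValue.abs) (x := q) (by
      intro j k
      simp only [AbsoluteValue.abs_apply, Matrix.updateCol_apply]
      split_ifs
      · simp only [b', abs_div, abs_of_pos hβ]
        exact ((div_le_one hβ).2 (hb j)).trans hq
      · exact hbd _ _)
    simpa [nsmul_eq_mul] using this
  calc |x i| ≤ |A.det| * |x i| := le_mul_of_one_le_left (abs_nonneg _) hdet
    _ = β * |A.cramer b' i| := by rw [← abs_mul, hcr, abs_mul, abs_of_pos hβ]
    _ ≤ β * ((Fintype.card κ).factorial * q ^ Fintype.card κ) := by gcongr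
    _ = _ := by ring

open Matrix in
/-- If the linear functional `b` is determined by integral functionals `a k` with entries bounded
by `q`, then it is controlled by them with an explicit constant. -/
theorem abs_dotProduct_le_of_integral {ι κ : Type*} [Fintype ι]
    (a : κ → ι → ℝ) (q : ℝ) (hq : 1 ≤ q) (hint : ∀ k i, ∃ z : ℤ, a k i = z)
    (hbd : ∀ k i, |a k i| ≤ q) (b : ι → ℝ) (β : ℝ) (hβ : 0 ≤ β) (hb : ∀ i, |b i| ≤ β)
    (hspan : ∀ c : ι → ℝ, (∀ k, a k ⬝ᵥ c = 0) → b ⬝ᵥ c = 0)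
    (c : ι → ℝ) (δ : ℝ) (hδ : 0 ≤ δ) (hc : ∀ k, |a k ⬝ᵥ c| ≤ δ) :
    |b ⬝ᵥ c| ≤ Fintype.card ι * ((Fintype.card ι).factorial * q ^ Fintype.card ι * β) * δ := by
  classical
  -- Duality: a functional vanishing on the common kernel of the `a k` lies in their span.
  have hmem : b ∈ Submodule.span ℝ (Set.range a) := by
    have h1 : dotProductEquiv ℝ ι b ∈
        Submodule.span ℝ (Set.range fun k => dotProductEquiv ℝ ι (a k)) := by
      apply FiniteDimensional.mem_span_of_iInf_ker_le_ker
      intro x hx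
      simp only [Submodule.mem_iInf, LinearMap.mem_ker, dotProductEquiv_apply_apply] at hx ⊢
      exact hspan x hx
    rw [Set.range_comp' , ← LinearEquiv.coe_coe, ← Submodule.map_span] at h1
    obtain ⟨y, hy, hyb⟩ := h1
    rwa [← (dotProductEquiv ℝ ι).injective hyb]
  -- Extract independent rows spanning the same space, then equally many independent columns. The
  -- resulting square block `B` is integral and invertible, and the coefficients of `b` in these
  -- rows solve a system with it.
  obtain ⟨κ', e, -, hsp, hli⟩ := exists_linearIndependent' ℝ a
  have hfin : Finite κ' := hli.finite
  have := Fintype.ofFinite κ'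
  rw [← hsp] at hmem
  obtain ⟨l, hl⟩ := (Submodule.mem_span_range_iff_exists_fun ℝ).1 hmem
  set A : Matrix κ' ι ℝ := Matrix.of fun k i => a (e k) i with hAdef
  obtain ⟨ι', f, hf, hfsp, hfli⟩ := exists_linearIndependent' ℝ A.col
  have hfin' : Finite ι' := hfli.finite
  have := Fintype.ofFinite ι'
  have hrank : A.rank = Fintype.card κ' := LinearIndependent.rank_matrix hli
  have hcard : Fintype.card ι' = Fintype.card κ' := by
    rw [← hrank, Matrix.rank_eq_finrank_span_cols, ← hfsp, finrank_span_eq_card hfli]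
  let g : κ' ≃ ι' := Fintype.equivOfCardEq hcard.symm
  have hN : Fintype.card κ' ≤ Fintype.card ι := by
    rw [← hcard]; exact Fintype.card_le_of_injective f hf
  set B : Matrix κ' κ' ℝ := Matrix.of fun i k => a (e k) (f (g i)) with hB
  have hBu : IsUnit B := by
    rw [← Matrix.linearIndependent_rows_iff_isUnit]
    exact hfli.comp g g.injective
  have hlam : ∀ k, |l k| ≤ (Fintype.card κ').factorial * q ^ Fintype.card κ' * β := by
    intro k
    refine exists_coeff_of_integral_matrix B hBu q hq (fun i j => hint _ _) (fun i j => hbd _ _)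
      (fun i => b (f (g i))) β hβ (fun i => hb _) l ?_ k
    ext i
    rw [← hl]
    simp [Matrix.mulVec, dotProduct, hB, mul_comm]
  calc |b ⬝ᵥ c| = |∑ k, l k * (a (e k) ⬝ᵥ c)| := by
        rw [← hl, sum_dotProduct]
        simp [smul_dotProduct]
    _ ≤ ∑ k, |l k * (a (e k) ⬝ᵥ c)| := Finset.abs_sum_le_sum_abs _ _
    _ ≤ ∑ _k : κ', ((Fintype.card κ').factorial * q ^ Fintype.card κ' * β) * δ := by
        refine Finset.sum_le_sum fun k _ => ?_
        rw [abs_mul]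
        exact mul_le_mul (hlam k) (hc _) (abs_nonneg _) (by positivity)
    _ = Fintype.card κ' * ((Fintype.card κ').factorial * q ^ Fintype.card κ' * β) * δ := by
        simp [mul_assoc]
    _ ≤ _ := by
        gcongr

/-- Products of `{0, 1/P, …, 1}`-valued coordinates are controlled by their low-degree moments. -/
theorem abs_sum_mul_prod_le {ι κ : Type*} [Fintype ι] [Fintype κ] (P d : ℕ) (hP : 1 ≤ P)
    (hd : Fintype.card ι * P ^ d < 2 * (P + 1) ^ d) (v : ι → κ → ℝ)
    (hv : ∀ i t, ∃ j : ℕ, j ≤ P ∧ v i t = (j : ℝ) / P) (c : ι → ℝ) (δ β : ℝ)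
    (hδ : 0 ≤ δ) (hβ : 0 ≤ β) (hb : ∀ i, ∏ t, v i t ≤ β)
    (hc : ∀ T : Finset κ, T.card ≤ d → |∑ i, c i * ∏ t ∈ T, v i t| ≤ δ) :
    |∑ i, c i * ∏ t, v i t| ≤ Fintype.card ι * (Fintype.card ι).factorial *
      (P : ℝ) ^ (d * (Fintype.card ι + 1)) * (β * δ) := by
  classical
  have hP0 : (0 : ℝ) < P := by exact_mod_cast hP
  have hP1 : (1 : ℝ) ≤ P := by exact_mod_cast hP
  have hv0 : ∀ i t, 0 ≤ v i t := fun i t => by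
    obtain ⟨j, -, h⟩ := hv i t; rw [h]; positivity
  have hv1 : ∀ i t, v i t ≤ 1 := fun i t => by
    obtain ⟨j, hj, h⟩ := hv i t
    rw [h, div_le_one hP0]; exact_mod_cast hj
  -- The factor `P ^ d` clears the denominators of every monomial of degree at most `d`. The target
  -- product is not rescaled: only its size `β` enters, so the final bound remains proportional to
  -- `β`.
  have key := abs_dotProduct_le_of_integral
    (a := fun (T : {T : Finset κ // T.card ≤ d}) i => (P : ℝ) ^ d * ∏ t ∈ T.1, v i t)
    (q := (P : ℝ) ^ d) (one_le_pow₀ hP1) (by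
      rintro ⟨T, hT⟩ i
      choose j _ hj using hv i
      refine ⟨P ^ (d - T.card) * ∏ t ∈ T, (j t : ℤ), ?_⟩
      push_cast
      simp_rw [hj, Finset.prod_div_distrib, Finset.prod_const]
      rw [← Nat.sub_add_cancel hT, pow_add]
      simp only [Nat.add_sub_cancel]
      field_simp) (by
      rintro ⟨T, hT⟩ i
      rw [abs_of_nonneg (mul_nonneg (by positivity) (Finset.prod_nonneg fun t _ => hv0 i t))]
      exact mul_le_of_le_one_right (by positivity)
        (Finset.prod_le_one (fun t _ => hv0 i t) fun t _ => hv1 i t))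
    (b := fun i => ∏ t, v i t) β hβ (fun i => by
      rw [abs_of_nonneg (Finset.prod_nonneg fun t _ => hv0 i t)]; exact hb i) (by
      intro x hx
      have := sum_mul_prod_eq_zero_of_low_degree v
        ((Finset.range (P + 1)).image fun j : ℕ => (j : ℝ) / P) P
        (Finset.card_image_le.trans (by simp)) (fun i t => by
          obtain ⟨j, hj, h⟩ := hv i t
          rw [h]
          exact Finset.mem_image_of_mem _ (Finset.mem_range.2 (by omega))) Finset.univ d
        Finset.univ x (by simpa using hd) (by
          intro T _ hT
          have h := hx ⟨T, hT⟩
          simp only [dotProduct, mul_assoc] at h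
          rw [← Finset.mul_sum] at h
          have h' := (mul_eq_zero.1 h).resolve_left (by positivity)
          rw [← h']
          exact Finset.sum_congr rfl fun i _ => mul_comm _ _)
      rw [← this]
      exact Finset.sum_congr rfl fun i _ => mul_comm _ _) c ((P : ℝ) ^ d * δ) (by positivity) (by
      rintro ⟨T, hT⟩
      have : (fun i => (P : ℝ) ^ d * ∏ t ∈ T, v i t) ⬝ᵥ c
          = (P : ℝ) ^ d * ∑ i, c i * ∏ t ∈ T, v i t := by
        rw [Finset.mul_sum]
        exact Finset.sum_congr rfl fun i _ => by ring
      rw [this, abs_mul, abs_of_nonneg (by positivity)]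
      gcongr
      exact hc T hT)
  have e : (fun i => ∏ t, v i t) ⬝ᵥ c = ∑ i, c i * ∏ t, v i t :=
    Finset.sum_congr rfl fun i _ => mul_comm _ _
  rw [e] at key
  refine key.trans (le_of_eq ?_)
  rw [← pow_mul, mul_add, pow_add, mul_one]
  ring

/-- The degree `⌈2 P log M⌉` suffices to distinguish `2 M` contexts. -/
theorem two_mul_card_mul_pow_lt (P M d : ℕ) (hP : 1 ≤ P) (hM : 2 ≤ M)
    (hd : 2 * (P : ℝ) * Real.log M ≤ d) : 2 * M * P ^ d < 2 * (P + 1) ^ d := by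
  have hP0 : (0 : ℝ) < P := by exact_mod_cast hP
  have hlogM : 0 < Real.log M := Real.log_pos (by exact_mod_cast hM)
  -- Bernoulli's inequality. Hence `P log (1 + 1/P) ≥ log 2 > 1/2`, which is why the factor `2` in
  -- `2P log M` is enough.
  have h2 : (2 : ℝ) ≤ (1 + 1 / P) ^ P := by
    have := one_add_mul_le_pow (a := (1 : ℝ) / P) (by
      have : (0 : ℝ) ≤ 1 / P := by positivity
      linarith) P
    rw [mul_one_div_cancel hP0.ne'] at this
    linarith
  have hlog2 : Real.log 2 ≤ P * Real.log (1 + 1 / P) := by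
    rw [← Real.log_pow]
    exact Real.log_le_log (by norm_num) h2
  have hl := Real.log_two_gt_d9
  have hx : Real.log M < d * Real.log (1 + 1 / P) := by
    have hnn : 0 ≤ Real.log (1 + 1 / P) := Real.log_nonneg (by
      have : (0 : ℝ) ≤ 1 / P := by positivity
      linarith)
    calc Real.log M < 2 * Real.log M * (P * Real.log (1 + 1 / P)) := by nlinarith
      _ = 2 * P * Real.log M * Real.log (1 + 1 / P) := by ring
      _ ≤ _ := by gcongr
  rw [← Real.log_pow] at hx
  have hM0 : (0 : ℝ) < M := by positivity
  have h3 : (M : ℝ) < (1 + 1 / P) ^ d := (Real.log_lt_log_iff hM0 (by positivity)).1 hx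
  have h4 : (M : ℝ) * P ^ d < (P + 1) ^ d := by
    have : (1 + 1 / (P : ℝ)) ^ d = (P + 1) ^ d / P ^ d := by
      rw [← div_pow]; congr 1; field_simp
    rw [this, lt_div_iff₀ (by positivity)] at h3
    exact h3
  have h5 : M * P ^ d < (P + 1) ^ d := by exact_mod_cast h4
  nlinarith

/-! ### Adaptively generated sequences, concentration and pigeonhole. -/

/-- The probability of the sequence `D` when each entry is drawn from the kernel `K` given the
preceding entries. -/
noncomputable def seqProb {α : Type*} (K : List α → α → ℝ) {N : ℕ} (D : Fin N → α) : ℝ :=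
  ∏ k : Fin N, K ((List.ofFn D).take k) (D k)

theorem List.take_ofFn_castSucc {α : Type*} {N : ℕ} (D : Fin (N + 1) → α) (k : ℕ) (hk : k ≤ N) :
    (List.ofFn D).take k = (List.ofFn fun i : Fin N => D i.castSucc).take k := by
  rw [List.ofFn_succ', List.concat_eq_append, List.take_append_of_le_length (by simpa using hk)]

theorem seqProb_snoc {α : Type*} (K : List α → α → ℝ) {N : ℕ} (D : Fin N → α) (a : α) :
    seqProb K (Fin.snoc D a : Fin (N + 1) → α) = seqProb K D * K (List.ofFn D) a := by
  unfold seqProb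
  rw [Fin.prod_univ_castSucc]
  congr 1
  · refine Finset.prod_congr rfl fun k _ => ?_
    rw [List.take_ofFn_castSucc _ _ (by simp [k.isLt.le])]
    simp
  · rw [List.take_ofFn_castSucc _ _ (by simp), List.take_of_length_le (by simp)]
    simp

theorem List.ofFn_snoc {α : Type*} {N : ℕ} (D : Fin N → α) (a : α) :
    List.ofFn (Fin.snoc D a : Fin (N + 1) → α) = List.ofFn D ++ [a] := by
  rw [List.ofFn_succ', List.concat_eq_append]
  simp

theorem Fin.sum_pi_snoc {α : Type*} [Fintype α] {N : ℕ} (f : (Fin (N + 1) → α) → ℝ) :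
    ∑ D, f D = ∑ D : Fin N → α, ∑ a, f (Fin.snoc D a) := by
  rw [← (Fin.snocEquiv fun _ : Fin (N + 1) => α).sum_comp, Fintype.sum_prod_type,
    Finset.sum_comm]
  rfl

theorem seqProb_nonneg {α : Type*} {K : List α → α → ℝ} (hK : ∀ h a, 0 ≤ K h a) {N : ℕ}
    (D : Fin N → α) : 0 ≤ seqProb K D :=
  Finset.prod_nonneg fun _ _ => hK _ _

/-- A potential that does not increase in expectation bounds the terminal expectation. -/
theorem sum_seqProb_mul_le {α : Type*} [Fintype α] {K : List α → α → ℝ}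
    (hK : ∀ h a, 0 ≤ K h a) (G : List α → ℝ) (N : ℕ)
    (hG : ∀ h, h.length < N → ∑ a, K h a * G (h ++ [a]) ≤ G h) :
    ∑ D : Fin N → α, seqProb K D * G (List.ofFn D) ≤ G [] := by
  induction N with
  | zero => simp [seqProb]
  | succ N ih =>
    rw [Fin.sum_pi_snoc]
    refine le_trans (Finset.sum_le_sum fun D _ => ?_) (ih fun h hh => hG h (by omega))
    simp_rw [seqProb_snoc, List.ofFn_snoc, mul_assoc]
    rw [← Finset.mul_sum]
    exact mul_le_mul_of_nonneg_left (hG _ (by simp)) (seqProb_nonneg hK D)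

theorem le_sum_seqProb_mul {α : Type*} [Fintype α] {K : List α → α → ℝ}
    (hK : ∀ h a, 0 ≤ K h a) (G : List α → ℝ) (N : ℕ)
    (hG : ∀ h, h.length < N → G h ≤ ∑ a, K h a * G (h ++ [a])) :
    G [] ≤ ∑ D : Fin N → α, seqProb K D * G (List.ofFn D) := by
  have := sum_seqProb_mul_le hK (fun h => - G h) N fun h hh => by
    simpa using hG h hh
  simpa using this

theorem sum_seqProb_eq_one {α : Type*} [Fintype α] {K : List α → α → ℝ}
    (hK : ∀ h a, 0 ≤ K h a) (hK1 : ∀ h, ∑ a, K h a = 1) (N : ℕ) :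
    ∑ D : Fin N → α, seqProb K D = 1 := by
  have h1 := sum_seqProb_mul_le hK (fun _ => 1) N fun h _ => by simp [hK1]
  have h2 := le_sum_seqProb_mul hK (fun _ => 1) N fun h _ => by simp [hK1]
  simp only [mul_one] at h1 h2
  exact le_antisymm h1 h2

theorem sum_seqProb_le_one {α : Type*} [Fintype α] {K : List α → α → ℝ}
    (hK : ∀ h a, 0 ≤ K h a) (hK1 : ∀ h, ∑ a, K h a ≤ 1) (N : ℕ) :
    ∑ D : Fin N → α, seqProb K D ≤ 1 := by
  have h1 := sum_seqProb_mul_le hK (fun _ => 1) N fun h _ => by simp [hK1]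
  simpa using h1

open Classical in
/-- The probability of the event `E` under `seqProb K`. -/
noncomputable def seqMeas {α : Type*} [Fintype α] (K : List α → α → ℝ) (N : ℕ)
    (E : (Fin N → α) → Prop) : ℝ :=
  ∑ D, if E D then seqProb K D else 0

section

variable {α : Type*} [Fintype α] {K : List α → α → ℝ} {N : ℕ}

/-- The implication is only required on sequences of positive probability, so that almost sure
facts, such as the absence of impossible rewards, can be used. -/
theorem seqMeas_mono (hK : ∀ h a, 0 ≤ K h a) {E F : (Fin N → α) → Prop}
    (h : ∀ D, 0 < seqProb K D → E D → F D) : seqMeas K N E ≤ seqMeas K N F := by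
  classical
  refine Finset.sum_le_sum fun D _ => ?_
  rcases (seqProb_nonneg hK D).eq_or_lt with h0 | h0
  · simp [← h0]
  · by_cases hE : E D
    · simp [hE, h D h0 hE]
    · simp only [hE, if_false]
      split_ifs <;> simp [h0.le]

theorem seqMeas_or_le (hK : ∀ h a, 0 ≤ K h a) (E F : (Fin N → α) → Prop) :
    seqMeas K N (fun D => E D ∨ F D) ≤ seqMeas K N E + seqMeas K N F := by
  classical
  unfold seqMeas
  rw [← Finset.sum_add_distrib]
  refine Finset.sum_le_sum fun D _ => ?_
  have := seqProb_nonneg hK D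
  by_cases hE : E D <;> by_cases hF : F D <;> simp [hE, hF, this]

theorem seqMeas_exists_le (hK : ∀ h a, 0 ≤ K h a) {ι : Type*} (I : Finset ι)
    (E : ι → (Fin N → α) → Prop) :
    seqMeas K N (fun D => ∃ i ∈ I, E i D) ≤ ∑ i ∈ I, seqMeas K N (E i) := by
  classical
  unfold seqMeas
  rw [Finset.sum_comm]
  refine Finset.sum_le_sum fun D _ => ?_
  have h0 := seqProb_nonneg hK D
  have hnn : ∀ i ∈ I, 0 ≤ if E i D then seqProb K D else 0 := fun i _ => by
    split_ifs <;> simp [h0]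
  split_ifs with h
  · obtain ⟨i, hi, hE⟩ := h
    exact le_trans (by simp [hE]) (Finset.single_le_sum hnn hi)
  · exact Finset.sum_nonneg hnn

/-- Markov's inequality, with a nonnegative weight dominating the indicator. -/
theorem seqMeas_le_of_one_le (hK : ∀ h a, 0 ≤ K h a) {E : (Fin N → α) → Prop}
    (W : (Fin N → α) → ℝ) (hW : ∀ D, 0 ≤ W D) (hE : ∀ D, E D → 1 ≤ W D) :
    seqMeas K N E ≤ ∑ D, seqProb K D * W D := by
  classical
  refine Finset.sum_le_sum fun D _ => ?_
  have h0 := seqProb_nonneg hK D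
  split_ifs with h
  · exact le_mul_of_one_le_right h0 (hE D h)
  · exact mul_nonneg h0 (hW D)

theorem one_sub_le_seqMeas (hK : ∀ h a, 0 ≤ K h a) (hK1 : ∀ h, ∑ a, K h a = 1)
    {E F : (Fin N → α) → Prop} (h : ∀ D, 0 < seqProb K D → ¬ F D → E D) :
    1 - seqMeas K N F ≤ seqMeas K N E := by
  classical
  rw [← sum_seqProb_eq_one hK hK1 N, sub_le_iff_le_add]
  unfold seqMeas
  rw [← Finset.sum_add_distrib]
  refine Finset.sum_le_sum fun D _ => ?_
  rcases (seqProb_nonneg hK D).eq_or_lt with h0 | h0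
  · simp [← h0]
  · by_cases hF : F D
    · simp only [hF, if_true]
      split_ifs <;> simp [h0.le]
    · simp [hF, h D h0 hF]

/-- A self-normalized deviation inequality for additive statistics of a sequence, uniform over its
prefixes. -/
theorem seqMeas_deviation_le (hK : ∀ h a, 0 ≤ K h a) (hK1 : ∀ h, ∑ a, K h a = 1)
    (cnt : α → ℕ) (B : ℕ) (hB : ∀ a, cnt a ≤ B) (score : α → ℝ)
    (h0 : ∀ a, cnt a = 0 → score a = 0)
    (hmgf : ∀ h l, ∑ a, K h a * Real.exp (l * score a - 2 * l ^ 2 * cnt a) ≤ 1)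
    (β : ℝ) (hβ : 0 ≤ β) :
    seqMeas K N (fun D => ∃ k ≤ N, β * √((((List.ofFn D).take k).map cnt).sum : ℕ) <
      |(((List.ofFn D).take k).map score).sum|) ≤
      N * (N * B) * (2 * Real.exp (- (β ^ 2 / 8))) := by
  classical
  -- The exponential supermartingale of the score, compensated by the count. Truncating at `k` stops
  -- it, which gives the bound for each prefix.
  set G : ℝ → List α → ℝ := fun l h =>
    Real.exp (l * (h.map score).sum - 2 * l ^ 2 * ((h.map cnt).sum : ℕ)) with hG
  have hGk : ∀ l k, ∑ D : Fin N → α, seqProb K D * G l ((List.ofFn D).take k) ≤ 1 := by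
    intro l k
    refine (sum_seqProb_mul_le hK (fun h => G l (h.take k)) N ?_).trans (by simp [hG])
    intro h _
    rcases lt_or_ge h.length k with hk | hk
    · have : ∀ a, G l ((h ++ [a]).take k)
          = G l h * Real.exp (l * score a - 2 * l ^ 2 * cnt a) := by
        intro a
        rw [List.take_of_length_le (by simpa using hk), hG, ← Real.exp_add]
        simp only [List.map_append, List.sum_append, List.map_cons, List.map_nil,
          List.sum_cons, List.sum_nil]
        push_cast
        congr 1; ring
      simp_rw [this, List.take_of_length_le hk.le, mul_left_comm _ (G l h)]
      rw [← Finset.mul_sum]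
      exact mul_le_of_le_one_right (Real.exp_pos _).le (hmgf h l)
    · simp_rw [List.take_append_of_le_length hk, ← Finset.sum_mul, hK1, one_mul]
      exact le_rfl
  have hcount : ∀ h : List α, (h.map cnt).sum ≤ h.length * B := by
    intro h
    have := List.sum_le_card_nsmul (h.map cnt) B (by
      intro x hx
      obtain ⟨a, -, rfl⟩ := List.mem_map.1 hx
      exact hB a)
    simpa using this
  have hzero : ∀ h : List α, (h.map cnt).sum = 0 → (h.map score).sum = 0 := by
    intro h hh
    rw [List.sum_eq_zero_iff] at hh
    apply List.sum_eq_zero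
    intro x hx
    obtain ⟨a, ha, rfl⟩ := List.mem_map.1 hx
    exact h0 a (hh _ (List.mem_map_of_mem ha))
  have hE : seqMeas K N (fun D => ∃ k ≤ N, β * √((((List.ofFn D).take k).map cnt).sum : ℕ) <
      -- The optimal exponent depends on the random count `n`. Hence a union over the prefix length
      -- `k` and the value of `n`, where `n = 0` is excluded because the score is then `0`.
      |(((List.ofFn D).take k).map score).sum|) ≤
      seqMeas K N (fun D => ∃ i ∈ Finset.Icc 1 N ×ˢ Finset.Icc 1 (N * B),
        (((List.ofFn D).take i.1).map cnt).sum = i.2 ∧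
          β * √(i.2) < |(((List.ofFn D).take i.1).map score).sum|) := by
    refine seqMeas_mono hK ?_
    rintro D - ⟨k, hk, hlt⟩
    set n := (((List.ofFn D).take k).map cnt).sum with hn
    have hn0 : n ≠ 0 := by
      intro h
      rw [hzero _ (hn ▸ h), h] at hlt
      simp at hlt
    have hk0 : k ≠ 0 := by
      rintro rfl
      simp [hn] at hn0
    refine ⟨(k, n), ?_, rfl, hlt⟩
    simp only [Finset.mem_product, Finset.mem_Icc]
    refine ⟨⟨by omega, hk⟩, by omega, (hcount _).trans ?_⟩
    gcongr
    simp
  have hfix : ∀ i ∈ Finset.Icc 1 N ×ˢ Finset.Icc 1 (N * B), seqMeas K N (fun D =>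
        (((List.ofFn D).take i.1).map cnt).sum = i.2 ∧
          β * √(i.2) < |(((List.ofFn D).take i.1).map score).sum|) ≤
      2 * Real.exp (- (β ^ 2 / 8)) := by
    rintro ⟨k, n⟩ hi
    simp only [Finset.mem_product, Finset.mem_Icc] at hi
    have hn : (0 : ℝ) < n := by exact_mod_cast hi.2.1
    have hs : (0 : ℝ) < √n := Real.sqrt_pos.2 hn
    have hss : √(n : ℝ) * √n = n := Real.mul_self_sqrt hn.le
    -- Optimizes `l β √n - 2 l² n`, whose maximum is `β² / 8`; the two signs of `l` give the two
    -- tails.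
    set l : ℝ := β / (4 * √n) with hl
    have hl0 : 0 ≤ l := by positivity
    have hl1 : l * (β * √n) = β ^ 2 / 4 := by
      rw [hl]; field_simp
    have hl2 : 2 * l ^ 2 * n = β ^ 2 / 8 := by
      rw [hl, div_pow, mul_pow, Real.sq_sqrt hn.le]; field_simp; ring
    refine (seqMeas_le_of_one_le hK (fun D => Real.exp (- (β ^ 2 / 8)) *
      (G l ((List.ofFn D).take k) + G (-l) ((List.ofFn D).take k))) (fun D => by positivity)
      ?_).trans ?_
    · rintro D ⟨hcnt, hdev⟩
      simp only at hcnt hdev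
      set s := (((List.ofFn D).take k).map score).sum with hs'
      have hpos : ∀ l', β ^ 2 / 4 ≤ l' * s → l' ^ 2 = l ^ 2 →
          1 ≤ Real.exp (- (β ^ 2 / 8)) * G l' ((List.ofFn D).take k) := by
        intro l' h1 h2
        simp only [hG]
        rw [← Real.exp_add, hcnt, h2, hl2, Real.one_le_exp_iff]
        linarith
      rw [mul_add]
      rcases lt_abs.1 hdev with h | h
      · have := hpos l (by rw [← hl1]; gcongr) rfl
        have h2 : 0 ≤ Real.exp (- (β ^ 2 / 8)) * G (-l) ((List.ofFn D).take k) := by positivity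
        linarith
      · have := hpos (-l) (by
          rw [← hl1]
          have := mul_le_mul_of_nonneg_left h.le hl0
          linarith) (by ring)
        have h2 : 0 ≤ Real.exp (- (β ^ 2 / 8)) * G l ((List.ofFn D).take k) := by positivity
        linarith
    · simp_rw [mul_left_comm _ (Real.exp (- (β ^ 2 / 8))), mul_add, Finset.sum_add_distrib]
      rw [← Finset.mul_sum, ← Finset.mul_sum]
      have h1 := mul_le_mul_of_nonneg_left (hGk l k) (Real.exp_pos (- (β ^ 2 / 8))).le
      have h2 := mul_le_mul_of_nonneg_left (hGk (-l) k) (Real.exp_pos (- (β ^ 2 / 8))).le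
      linarith
  refine hE.trans ((seqMeas_exists_le hK _ _).trans ((Finset.sum_le_sum hfix).trans ?_))
  simp

/-- A nonnegative bounded predictable sum is at most twice the realized sum, up to a term
logarithmic in the failure probability. -/
theorem seqMeas_predictable_sum_le (hK : ∀ h a, 0 ≤ K h a) (hK1 : ∀ h, ∑ a, K h a = 1)
    (φ : List α → α → ℝ) (hφ0 : ∀ h a, 0 ≤ φ h a) (hφ1 : ∀ h a, φ h a ≤ 1) (x : ℝ) :
    seqMeas K N (fun D => ∑ k : Fin N, φ ((List.ofFn D).take k) (D k) + x <
      (∑ k : Fin N, ∑ a, K ((List.ofFn D).take k) a * φ ((List.ofFn D).take k) a) / 2) ≤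
      Real.exp (-x) := by
  classical
  -- Tilting by `exp (mean / 2 - φ)` gives a substochastic kernel, because `exp (-φ) ≤ 1 - φ / 2`
  -- for `φ ∈ [0, 1]`. Its total mass is at most `1`, and Markov's inequality concludes.
  set ψ : List α → α → ℝ := fun h a => (∑ b, K h b * φ h b) / 2 - φ h a with hψ
  set K' : List α → α → ℝ := fun h a => K h a * Real.exp (ψ h a) with hK'
  have hK'0 : ∀ h a, 0 ≤ K' h a := fun h a => mul_nonneg (hK h a) (Real.exp_pos _).le
  have hK'1 : ∀ h, ∑ a, K' h a ≤ 1 := by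
    intro h
    set m := ∑ b, K h b * φ h b with hm
    have h1 : ∀ a, K' h a ≤ Real.exp (m / 2) * (K h a * (1 - φ h a / 2)) := by
      intro a
      have h2 : Real.exp (- φ h a) ≤ 1 - φ h a / 2 := by
        have hp := hφ0 h a
        have hp1 := hφ1 h a
        have h3 := Real.add_one_le_exp (φ h a)
        rw [Real.exp_neg, inv_le_comm₀ (Real.exp_pos _) (by linarith)]
        refine le_trans ?_ h3
        rw [inv_le_iff_one_le_mul₀ (by linarith)]
        nlinarith
      simp only [hK', hψ]
      rw [sub_eq_add_neg, Real.exp_add]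
      have := mul_le_mul_of_nonneg_left h2 (mul_nonneg (hK h a) (Real.exp_pos (m / 2)).le)
      calc _ = K h a * Real.exp (m / 2) * Real.exp (- φ h a) := by ring
        _ ≤ _ := this
        _ = _ := by ring
    refine (Finset.sum_le_sum fun a _ => h1 a).trans ?_
    rw [← Finset.mul_sum]
    have h2 : ∑ a, K h a * (1 - φ h a / 2) = 1 - m / 2 := by
      rw [hm, Finset.sum_div]
      nth_rewrite 2 [← hK1 h]
      rw [← Finset.sum_sub_distrib]
      exact Finset.sum_congr rfl fun a _ => by ring
    rw [h2]
    have h3 := Real.add_one_le_exp (- (m / 2))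
    calc Real.exp (m / 2) * (1 - m / 2) ≤ Real.exp (m / 2) * Real.exp (- (m / 2)) := by
          gcongr; linarith
      _ = 1 := by rw [← Real.exp_add]; simp
  have hsum := sum_seqProb_le_one hK'0 hK'1 N
  refine (seqMeas_le_of_one_le hK (fun D => Real.exp (-x) *
    Real.exp (∑ k : Fin N, ψ ((List.ofFn D).take k) (D k))) (fun D => by positivity) ?_).trans ?_
  · intro D hD
    rw [← Real.exp_add, Real.one_le_exp_iff]
    simp only [hψ]
    rw [Finset.sum_sub_distrib, ← Finset.sum_div]
    linarith
  · simp_rw [mul_left_comm _ (Real.exp (-x))]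
    rw [← Finset.mul_sum]
    refine mul_le_of_le_one_right (Real.exp_pos _).le (le_trans (le_of_eq ?_) hsum)
    refine Finset.sum_congr rfl fun D _ => ?_
    simp only [seqProb, hK']
    rw [Finset.prod_mul_distrib, Real.exp_sum]

end

/-- Hoeffding's lemma for a finitely supported probability vector. -/
theorem sum_mul_exp_le {ι : Type*} [Fintype ι] (q y : ι → ℝ) (hq : ∀ i, 0 ≤ q i)
    (hq1 : ∑ i, q i = 1) (hy : ∀ i, |y i| ≤ 1) (m : ℝ) (hm : m = ∑ i, q i * y i) (l : ℝ) :
    ∑ i, q i * Real.exp (l * (y i - m)) ≤ Real.exp (2 * l ^ 2) := by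
  -- Symmetrization: by Jensen the mean is replaced by an independent copy. The difference is
  -- symmetric, so `exp` becomes `cosh`, and `cosh x ≤ exp (x² / 2)` with differences at most `2`
  -- gives `2 l²`.
  have hj : Real.exp (- (l * m)) ≤ ∑ j, q j * Real.exp (- (l * y j)) := by
    have := convexOn_exp.map_sum_le (t := Finset.univ) (w := q) (p := fun j => - (l * y j))
      (fun i _ => hq i) hq1 (by simp)
    simp only [smul_eq_mul] at this
    refine le_trans (le_of_eq ?_) this
    congr 1
    rw [hm, Finset.mul_sum, ← Finset.sum_neg_distrib]
    exact Finset.sum_congr rfl fun i _ => by ring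
  have hcosh : ∑ i, ∑ j, q i * q j * Real.exp (l * (y i - y j)) =
      ∑ i, ∑ j, q i * q j * Real.cosh (l * (y i - y j)) := by
    have hsw : ∑ i, ∑ j, q i * q j * Real.exp (l * (y i - y j)) =
        ∑ i, ∑ j, q i * q j * Real.exp (- (l * (y i - y j))) := by
      rw [Finset.sum_comm]
      exact Finset.sum_congr rfl fun i _ => Finset.sum_congr rfl fun j _ => by
        rw [mul_comm (q j)]; congr 2; ring
    simp_rw [Real.cosh_eq, mul_div_assoc', mul_add, ← Finset.sum_div, Finset.sum_add_distrib]
    rw [← hsw]; ring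
  calc ∑ i, q i * Real.exp (l * (y i - m))
      = ∑ i, q i * Real.exp (l * y i) * Real.exp (- (l * m)) := by
        refine Finset.sum_congr rfl fun i _ => ?_
        rw [mul_assoc, ← Real.exp_add]; congr 2; ring
    _ ≤ ∑ i, q i * Real.exp (l * y i) * ∑ j, q j * Real.exp (- (l * y j)) := by
        refine Finset.sum_le_sum fun i _ => ?_
        exact mul_le_mul_of_nonneg_left hj (mul_nonneg (hq i) (Real.exp_pos _).le)
    _ = ∑ i, ∑ j, q i * q j * Real.exp (l * (y i - y j)) := by
        refine Finset.sum_congr rfl fun i _ => ?_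
        rw [Finset.mul_sum]
        refine Finset.sum_congr rfl fun j _ => ?_
        rw [mul_sub, sub_eq_add_neg, Real.exp_add]; ring
    _ = ∑ i, ∑ j, q i * q j * Real.cosh (l * (y i - y j)) := hcosh
    _ ≤ ∑ i, ∑ j, q i * q j * Real.exp (2 * l ^ 2) := by
        refine Finset.sum_le_sum fun i _ => Finset.sum_le_sum fun j _ => ?_
        refine mul_le_mul_of_nonneg_left ((Real.cosh_le_exp_half_sq _).trans ?_)
          (mul_nonneg (hq i) (hq j))
        rw [Real.exp_le_exp, mul_pow]
        have h1 := abs_le.1 (hy i)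
        have h2 := abs_le.1 (hy j)
        have : (y i - y j) ^ 2 ≤ 4 := by nlinarith
        nlinarith [sq_nonneg l]
    _ = Real.exp (2 * l ^ 2) := by
        simp_rw [← Finset.sum_mul, ← Finset.mul_sum, hq1, mul_one, hq1, one_mul]

/-- The pigeonhole estimate for inverse square roots of visit counts. -/
theorem sum_inv_sqrt_visits_le {γ : Type*} [Fintype γ] [DecidableEq γ] (y : ℕ → γ) (N : ℕ)
    (n : ℕ → ℕ) (hn : ∀ k < N, ((Finset.range k).filter fun j => y j = y k).card ≤ n k) :
    ∑ k ∈ Finset.range N, 1 / √((n k : ℝ) + 1) ≤ 2 * √(Fintype.card γ * N) := by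
  set c : ℕ → γ → ℕ := fun k g => ((Finset.range k).filter fun j => y j = g).card with hc
  -- Each visit to a label raises `2 √count` by at least its inverse square root, so the sum
  -- telescopes for each label; Cauchy–Schwarz then combines the labels.
  have hstep : ∀ m : ℕ, 1 / √((m : ℝ) + 1) ≤ 2 * √((m : ℝ) + 1) - 2 * √m := by
    intro m
    have hm : (0 : ℝ) ≤ m := by positivity
    have h1 : 0 < √((m : ℝ) + 1) := Real.sqrt_pos.2 (by linarith)
    have h2 := Real.sqrt_nonneg (m : ℝ)
    have h3 := Real.mul_self_sqrt (show (0 : ℝ) ≤ m + 1 by linarith)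
    have h4 := Real.mul_self_sqrt hm
    rw [div_le_iff₀ h1]
    nlinarith [sq_nonneg (√((m : ℝ) + 1) - √m)]
  have hind : ∀ k ≤ N, ∑ j ∈ Finset.range k, 1 / √((n j : ℝ) + 1) ≤ ∑ g, 2 * √(c k g) := by
    intro k
    induction k with
    | zero => intro _; simp [hc]
    | succ k ih =>
      intro hk
      rw [Finset.sum_range_succ]
      have hcs : ∀ g, c (k + 1) g = c k g + if y k = g then 1 else 0 := by
        intro g
        simp only [hc, Finset.range_add_one, Finset.filter_insert]
        split_ifs with h
        · rw [Finset.card_insert_of_notMem (by simp)]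
        · simp
      have h1 : 1 / √((n k : ℝ) + 1) ≤ 1 / √((c k (y k) : ℝ) + 1) := by
        have h2 : c k (y k) ≤ n k := hn k (by omega)
        gcongr
      have h3 : ∑ g, 2 * √(c (k + 1) g) = ∑ g, 2 * √(c k g)
          + (2 * √((c k (y k) : ℝ) + 1) - 2 * √(c k (y k))) := by
        rw [← sub_eq_iff_eq_add', ← Finset.sum_sub_distrib, Finset.sum_eq_single (y k)]
        · rw [hcs]; simp
        · intro g _ hg
          rw [hcs]; simp [hg.symm]
        · simp
      rw [h3]
      linarith [ih (by omega), hstep (c k (y k))]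
  refine (hind N le_rfl).trans ?_
  rw [← Finset.mul_sum]
  have hcs := Finset.sum_mul_sq_le_sq_mul_sq Finset.univ (fun _ : γ => (1 : ℝ))
    (fun g => √(c N g))
  have htot : ∑ g, (c N g : ℝ) = N := by
    have := Finset.card_eq_sum_card_fiberwise (s := Finset.range N) (t := Finset.univ) (f := y)
      (by simp)
    simp only [Finset.card_range] at this
    exact_mod_cast this.symm
  simp only [one_mul, one_pow, Finset.sum_const, Finset.card_univ, nsmul_eq_mul, mul_one,
    Real.sq_sqrt (Nat.cast_nonneg _), htot] at hcs
  have := Real.le_sqrt_of_sq_le hcs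
  linarith

/-! ### Trajectories, visits and deviation scores. -/

namespace RMMDP

section

variable {S A : Type*} {Z : Finset ℝ}

/-- The state-action pair of one time step. -/
def stateAction (a : S × A × Z) : S × A := (a.1, a.2.1)

/-- The state-action pair that precedes the time `h.length`, if any. -/
def lastPair (h : List (S × A × Z)) : Option (S × A) := (h.map stateAction).getLast?

/-- The state-action pair that precedes time `t`, if any. -/
def prevPair {H : ℕ} (τ : Trajectory S A Z H) (t : Fin H) : Option (S × A) := lastPair (past τ t)

open Classical in
/-- One step of the episode: transition kernel `p`, policy `π`, reward distributions `g`. -/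
noncomputable def stepKernel (p : Option (S × A) → S → ℝ) (π : Policy S A Z) (g : S → A → Z → ℝ)
    (h : List (S × A × Z)) (a : S × A × Z) : ℝ :=
  p (lastPair h) a.1 * (if a.2.1 = π h a.1 then 1 else 0) * g a.1 a.2.1 a.2.2

open Classical in
/-- The marginal of `stepKernel` on state-action pairs, for a policy that ignores rewards. -/
noncomputable def pairKernel (p : Option (S × A) → S → ℝ) (π : List (S × A) → S → A)
    (h : List (S × A)) (x : S × A) : ℝ :=
  p h.getLast? x.1 * (if x.2 = π h x.1 then 1 else 0)

theorem stepKernel_nonneg {p : Option (S × A) → S → ℝ} {π : Policy S A Z} {g : S → A → Z → ℝ}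
    (hp : ∀ y s, 0 ≤ p y s) (hg : ∀ s a z, 0 ≤ g s a z) (h : List (S × A × Z)) (a : S × A × Z) :
    0 ≤ stepKernel p π g h a := by
  unfold stepKernel
  have := hp (lastPair h) a.1
  have := hg a.1 a.2.1 a.2.2
  split_ifs <;> simp only [mul_one, mul_zero, zero_mul, le_refl]
  positivity

theorem pairKernel_nonneg {p : Option (S × A) → S → ℝ} {π : List (S × A) → S → A}
    (hp : ∀ y s, 0 ≤ p y s) (h : List (S × A)) (x : S × A) : 0 ≤ pairKernel p π h x := by
  unfold pairKernel
  have := hp h.getLast? x.1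
  split_ifs <;> simp [this]

theorem sum_stepKernel_mul [Fintype S] [Fintype A] (p : Option (S × A) → S → ℝ)
    (π : Policy S A Z) (g : S → A → Z → ℝ) (h : List (S × A × Z)) (f : S × A × Z → ℝ) :
    ∑ a, stepKernel p π g h a * f a =
      ∑ s, p (lastPair h) s * ∑ z, g s (π h s) z * f (s, π h s, z) := by
  classical
  rw [Fintype.sum_prod_type]
  refine Finset.sum_congr rfl fun s _ => ?_
  rw [Fintype.sum_prod_type, Finset.sum_eq_single (π h s)]
  · rw [Finset.mul_sum]
    exact Finset.sum_congr rfl fun z _ => by simp [stepKernel, mul_assoc]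
  · intro a _ ha
    exact Finset.sum_eq_zero fun z _ => by simp [stepKernel, ha]
  · simp

theorem sum_pairKernel_mul [Fintype S] [Fintype A] (p : Option (S × A) → S → ℝ)
    (π : List (S × A) → S → A) (h : List (S × A)) (f : S × A → ℝ) :
    ∑ x, pairKernel p π h x * f x = ∑ s, p h.getLast? s * f (s, π h s) := by
  classical
  rw [Fintype.sum_prod_type]
  refine Finset.sum_congr rfl fun s _ => ?_
  rw [Finset.sum_eq_single (π h s)]
  · simp [pairKernel]
  · intro a _ ha
    simp [pairKernel, ha]
  · simp

/-- The state-action pairs of a trajectory. -/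
def pairSeq {H : ℕ} (τ : Trajectory S A Z H) (t : Fin H) : S × A := stateAction (τ t)

/-- The rewards of a trajectory. -/
def rewardSeq {H : ℕ} (τ : Trajectory S A Z H) (t : Fin H) : Z := (τ t).2.2

/-- The trajectory with given state-action pairs and rewards. -/
def mkTrajectory {H : ℕ} (ξ : Fin H → S × A) (r : Fin H → Z) : Trajectory S A Z H :=
  fun t => ((ξ t).1, (ξ t).2, r t)

/-- The pairs `x` occur, at distinct times, in the sequence `ξ`. -/
def Visits {d H : ℕ} (x : Fin d → S × A) (ξ : Fin H → S × A) : Prop :=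
  ∃ t : Fin d ↪ Fin H, ξ ∘ t = x

/-- Times at which the pairs `x` occur. -/
noncomputable def Visits.times {d H : ℕ} {x : Fin d → S × A} {ξ : Fin H → S × A}
    (h : Visits x ξ) : Fin d ↪ Fin H := Exists.choose h

theorem Visits.comp_times {d H : ℕ} {x : Fin d → S × A} {ξ : Fin H → S × A} (h : Visits x ξ) :
    ξ ∘ h.times = x := Exists.choose_spec h

open Classical in
/-- Whether the pairs `x` occur in `ξ`, as a number. -/
noncomputable def visitCount {d H : ℕ} (x : Fin d → S × A) (ξ : Fin H → S × A) : ℕ :=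
  if Visits x ξ then 1 else 0

theorem visitCount_le {d H : ℕ} (x : Fin d → S × A) (ξ : Fin H → S × A) :
    visitCount x ξ ≤ 1 := by
  unfold visitCount; split_ifs <;> simp

open Classical in
/-- The number of transitions out of `y`. -/
noncomputable def transCount {H : ℕ} (y : Option (S × A)) (τ : Trajectory S A Z H) : ℕ :=
  (Finset.univ.filter fun t => prevPair τ t = y).card

theorem transCount_le {H : ℕ} (y : Option (S × A)) (τ : Trajectory S A Z H) : transCount y τ ≤ H :=
  (Finset.card_le_univ _).trans (by simp)

/-- `1` or `-1` according to `b`. -/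
def signOf (b : Bool) : ℝ := if b then 1 else -1

theorem abs_signOf (b : Bool) : |signOf b| = 1 := by cases b <;> simp [signOf]

open Classical in
/-- The deviation of the signed next states after `y` from their mean under the kernel `p`. -/
noncomputable def transScore [Fintype S] {H : ℕ} (p : Option (S × A) → S → ℝ) (y : Option (S × A)) (b : S → Bool)
    (τ : Trajectory S A Z H) : ℝ :=
  ∑ t, if prevPair τ t = y then signOf (b (τ t).1) - ∑ s, p y s * signOf (b s) else 0

theorem transScore_eq_zero [Fintype S] {H : ℕ} (p : Option (S × A) → S → ℝ) (y : Option (S × A)) (b : S → Bool)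
    (τ : Trajectory S A Z H) (h : transCount y τ = 0) : transScore p y b τ = 0 := by
  classical
  refine Finset.sum_eq_zero fun t _ => ?_
  rw [if_neg]
  unfold transCount at h
  rw [Finset.card_eq_zero, Finset.filter_eq_empty_iff] at h
  exact h (Finset.mem_univ t)

theorem map_stateAction_past {H : ℕ} (τ : Trajectory S A Z H) (t : Fin H) :
    (past τ t).map stateAction = (List.ofFn (pairSeq τ)).take t := by
  unfold past
  rw [List.map_take, List.map_ofFn]
  rfl

end

/-! ### The law of an episode and exponential moments of the scores. -/

section

variable {S A : Type*} [Fintype S] [Fintype A] {Z : Finset ℝ} {M H : ℕ}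

/-- The state dynamics, with the initial distribution at `none`. -/
def kernel (𝓜 : RMMDP S A Z M) : Option (S × A) → S → ℝ
  | none => 𝓜.ν
  | some x => 𝓜.T x.1 x.2

theorem kernel_nonneg (𝓜 : RMMDP S A Z M) (y : Option (S × A)) (s : S) : 0 ≤ 𝓜.kernel y s := by
  cases y
  · exact 𝓜.ν_nonneg s
  · exact 𝓜.T_nonneg _ _ s

theorem kernel_sum (𝓜 : RMMDP S A Z M) (y : Option (S × A)) : ∑ s, 𝓜.kernel y s = 1 := by
  cases y
  · exact 𝓜.ν_sum
  · exact 𝓜.T_sum _ _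

theorem stateProb_eq (𝓜 : RMMDP S A Z M) (τ : Trajectory S A Z H) (t : Fin H) :
    𝓜.stateProb τ t = 𝓜.kernel (prevPair τ t) (τ t).1 := by
  unfold stateProb prevPair lastPair past
  split_ifs with h
  · simp [h, kernel]
  · have ht := t.isLt
    rw [List.getLast?_eq_getElem?]
    simp [kernel, stateAction, List.getElem?_take]
    rw [if_pos (by omega), dif_pos (by omega)]

/-- Given the context, an episode is a sequence generated step by step from its history, so its law
is a mixture of `seqProb`s. -/
theorem trajProb_eq_sum (𝓜 : RMMDP S A Z M) (π : Policy S A Z) (τ : Trajectory S A Z H) :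
    𝓜.trajProb π τ = ∑ m, 𝓜.w m * seqProb (stepKernel 𝓜.kernel π (𝓜.μ m)) τ := by
  unfold trajProb rewardProb seqProb stepKernel
  rw [Finset.mul_sum]
  refine Finset.sum_congr rfl fun m _ => ?_
  simp_rw [Finset.prod_mul_distrib, stateProb_eq]
  simp only [prevPair, past]
  rw [mul_left_comm]
  rfl

/-- When actions do not depend on rewards, the pairs carry no information on the context: their law
splits off, and `rewardProb` is the conditional law of the rewards given the pairs. This is why
exploration is reward-blind. -/
theorem trajProb_eq_pair (𝓜 : RMMDP S A Z M) (π : List (S × A) → S → A)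
    (τ : Trajectory S A Z H) :
    𝓜.trajProb (fun h s => π (h.map stateAction) s) τ =
      seqProb (pairKernel 𝓜.kernel π) (pairSeq τ) * 𝓜.rewardProb τ := by
  classical
  unfold trajProb seqProb pairKernel
  simp_rw [Finset.prod_mul_distrib, stateProb_eq, prevPair, lastPair, map_stateAction_past]
  congr 2

theorem sum_stepKernel (𝓜 : RMMDP S A Z M) (π : Policy S A Z) (m : Fin M)
    (h : List (S × A × Z)) : ∑ a, stepKernel 𝓜.kernel π (𝓜.μ m) h a = 1 := by
  have := sum_stepKernel_mul 𝓜.kernel π (𝓜.μ m) h (fun _ => 1)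
  simpa [-Finset.univ_eq_attach, 𝓜.μ_sum, 𝓜.kernel_sum] using this

theorem sum_pairKernel (𝓜 : RMMDP S A Z M) (π : List (S × A) → S → A)
    (h : List (S × A)) : ∑ a, pairKernel 𝓜.kernel π h a = 1 := by
  have := sum_pairKernel_mul 𝓜.kernel π h (fun _ => 1)
  simpa [𝓜.kernel_sum] using this

theorem rewardProb_nonneg (𝓜 : RMMDP S A Z M) (τ : Trajectory S A Z H) : 0 ≤ 𝓜.rewardProb τ :=
  Finset.sum_nonneg fun m _ => mul_nonneg (𝓜.w_nonneg m)
    (Finset.prod_nonneg fun _ _ => 𝓜.μ_nonneg _ _ _ _)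

theorem trajProb_nonneg (𝓜 : RMMDP S A Z M) (π : Policy S A Z) (τ : Trajectory S A Z H) :
    0 ≤ 𝓜.trajProb π τ := by
  rw [trajProb_eq_sum]
  exact Finset.sum_nonneg fun m _ => mul_nonneg (𝓜.w_nonneg m)
    (seqProb_nonneg (stepKernel_nonneg 𝓜.kernel_nonneg (𝓜.μ_nonneg m)) τ)

theorem sum_trajProb (𝓜 : RMMDP S A Z M) (π : Policy S A Z) :
    ∑ τ : Trajectory S A Z H, 𝓜.trajProb π τ = 1 := by
  simp_rw [trajProb_eq_sum]
  rw [Finset.sum_comm]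
  simp_rw [← Finset.mul_sum]
  rw [← 𝓜.w_sum]
  refine Finset.sum_congr rfl fun m _ => ?_
  rw [sum_seqProb_eq_one (stepKernel_nonneg 𝓜.kernel_nonneg (𝓜.μ_nonneg m))
    (𝓜.sum_stepKernel π m), mul_one]

/-- Hoeffding's lemma is applied at every transition out of `y`: the exponential factors into one
tilt per step, which makes the step kernel of each context substochastic. Arbitrary policies are
allowed since the transitions do not depend on the context. -/
theorem sum_trajProb_mul_exp_transScore_le (𝓜 : RMMDP S A Z M) (π : Policy S A Z)
    (y : Option (S × A)) (b : S → Bool) (l : ℝ) :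
    ∑ τ : Trajectory S A Z H, 𝓜.trajProb π τ *
      Real.exp (l * transScore 𝓜.kernel y b τ - 2 * l ^ 2 * transCount y τ) ≤ 1 := by
  classical
  set φ : Option (S × A) → S → ℝ := fun y' s => if y' = y then
    Real.exp (l * (signOf (b s) - ∑ s, 𝓜.kernel y s * signOf (b s)) - 2 * l ^ 2) else 1 with hφ
  have hφ0 : ∀ y' s, 0 ≤ φ y' s := fun y' s => by
    simp only [hφ]; split_ifs <;> positivity
  have hφ1 : ∀ y', ∑ s, 𝓜.kernel y' s * φ y' s ≤ 1 := by
    intro y'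
    by_cases h : y' = y
    · subst h
      have := sum_mul_exp_le (𝓜.kernel y') (fun s => signOf (b s)) (𝓜.kernel_nonneg y')
        (𝓜.kernel_sum y') (fun s => (abs_signOf _).le) _ rfl l
      simp only [hφ, if_true, sub_eq_add_neg _ (2 * l ^ 2), Real.exp_add]
      simp_rw [← mul_assoc]
      rw [← Finset.sum_mul]
      calc _ ≤ Real.exp (2 * l ^ 2) * Real.exp (-(2 * l ^ 2)) := by gcongr
        _ = 1 := by rw [← Real.exp_add]; simp
    · simp [hφ, h, 𝓜.kernel_sum]
  have hexp : ∀ τ : Trajectory S A Z H,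
      Real.exp (l * transScore 𝓜.kernel y b τ - 2 * l ^ 2 * transCount y τ)
        = ∏ t, φ (prevPair τ t) (τ t).1 := by
    intro τ
    have : l * transScore 𝓜.kernel y b τ - 2 * l ^ 2 * transCount y τ =
        ∑ t, if prevPair τ t = y then
          l * (signOf (b (τ t).1) - ∑ s, 𝓜.kernel y s * signOf (b s)) - 2 * l ^ 2 else 0 := by
      unfold transScore transCount
      rw [Finset.card_filter, Nat.cast_sum, Finset.mul_sum, Finset.mul_sum,
        ← Finset.sum_sub_distrib]
      refine Finset.sum_congr rfl fun t _ => ?_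
      split_ifs <;> simp
    rw [this, Real.exp_sum]
    refine Finset.prod_congr rfl fun t _ => ?_
    simp only [hφ]
    split_ifs <;> simp
  simp_rw [trajProb_eq_sum, Finset.sum_mul]
  rw [Finset.sum_comm]
  simp_rw [mul_assoc, ← Finset.mul_sum]
  rw [← 𝓜.w_sum]
  refine Finset.sum_le_sum fun m _ => mul_le_of_le_one_right (𝓜.w_nonneg m) ?_
  have h0 := stepKernel_nonneg (π := π) 𝓜.kernel_nonneg (𝓜.μ_nonneg m)
  refine le_trans (le_of_eq ?_) (sum_seqProb_le_one
    (K := fun h a => stepKernel 𝓜.kernel π (𝓜.μ m) h a * φ (lastPair h) a.1)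
    (fun h a => mul_nonneg (h0 h a) (hφ0 _ _)) ?_ H)
  · refine Finset.sum_congr rfl fun τ _ => ?_
    rw [← mul_assoc 2, hexp]
    simp only [seqProb]
    rw [← Finset.prod_mul_distrib]
    rfl
  · intro h
    rw [sum_stepKernel_mul 𝓜.kernel π (𝓜.μ m) h (fun a => φ (lastPair h) a.1)]
    simp_rw [← Finset.sum_mul, 𝓜.μ_sum, one_mul]
    exact hφ1 _

/-! ### Moments -/

/-- The probability of the partially specified rewards `o` at the pairs `x`. -/
noncomputable def moment {ι : Type*} [Fintype ι] (𝓜 : RMMDP S A Z M) (x : ι → S × A)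
    (o : ι → Option Z) : ℝ :=
  ∑ m, 𝓜.w m * ∏ j, (o j).elim 1 (𝓜.μ m (x j).1 (x j).2)

open Classical in
/-- The indicator that the rewards `r` agree with the partially specified `o`. -/
noncomputable def agree {ι : Type*} [Fintype ι] (o : ι → Option Z) (r : ι → Z) : ℝ :=
  ∏ j, (o j).elim 1 (fun z => if r j = z then 1 else 0)

open Classical in
/-- The deviation of the indicator of the rewards `o` at an occurrence of `x` from its mean. -/
noncomputable def momentScore {d : ℕ} (𝓜 : RMMDP S A Z M) (x : Fin d → S × A)
    (o : Fin d → Option Z) (ξ : Fin H → S × A) (r : Fin H → Z) : ℝ :=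
  if h : Visits x ξ then agree o (r ∘ h.times) - 𝓜.moment x o else 0

theorem agree_nonneg {ι : Type*} [Fintype ι] (o : ι → Option Z) (r : ι → Z) : 0 ≤ agree o r := by
  classical
  refine Finset.prod_nonneg fun j _ => ?_
  cases o j
  · simp
  · simp only [Option.elim]; split_ifs <;> simp

theorem agree_le_one {ι : Type*} [Fintype ι] (o : ι → Option Z) (r : ι → Z) : agree o r ≤ 1 := by
  classical
  refine Finset.prod_le_one (fun j _ => ?_) fun j _ => ?_
  · cases o j
    · simp
    · simp only [Option.elim]; split_ifs <;> simp
  · cases o j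
    · simp
    · simp only [Option.elim]; split_ifs <;> simp

theorem μ_le_one (𝓜 : RMMDP S A Z M) (m : Fin M) (s : S) (a : A) (z : Z) : 𝓜.μ m s a z ≤ 1 := by
  rw [← 𝓜.μ_sum m s a]
  exact Finset.single_le_sum (fun z _ => 𝓜.μ_nonneg m s a z) (Finset.mem_univ z)

theorem elim_nonneg (𝓜 : RMMDP S A Z M) (m : Fin M) (x : S × A) (o : Option Z) :
    0 ≤ o.elim 1 (𝓜.μ m x.1 x.2) := by
  cases o
  · simp
  · exact 𝓜.μ_nonneg _ _ _ _

theorem elim_le_one (𝓜 : RMMDP S A Z M) (m : Fin M) (x : S × A) (o : Option Z) :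
    o.elim 1 (𝓜.μ m x.1 x.2) ≤ 1 := by
  cases o
  · simp
  · exact 𝓜.μ_le_one _ _ _ _

theorem moment_nonneg {ι : Type*} [Fintype ι] (𝓜 : RMMDP S A Z M) (x : ι → S × A)
    (o : ι → Option Z) : 0 ≤ 𝓜.moment x o :=
  Finset.sum_nonneg fun m _ => mul_nonneg (𝓜.w_nonneg m)
    (Finset.prod_nonneg fun _ _ => 𝓜.elim_nonneg _ _ _)

theorem moment_le_one {ι : Type*} [Fintype ι] (𝓜 : RMMDP S A Z M) (x : ι → S × A)
    (o : ι → Option Z) : 𝓜.moment x o ≤ 1 := by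
  rw [← 𝓜.w_sum]
  exact Finset.sum_le_sum fun m _ => mul_le_of_le_one_right (𝓜.w_nonneg m)
    (Finset.prod_le_one (fun _ _ => 𝓜.elim_nonneg _ _ _) fun _ _ => 𝓜.elim_le_one _ _ _)

theorem momentScore_eq_zero {d : ℕ} (𝓜 : RMMDP S A Z M) (x : Fin d → S × A)
    (o : Fin d → Option Z) (ξ : Fin H → S × A) (r : Fin H → Z) (h : visitCount x ξ = 0) :
    𝓜.momentScore x o ξ r = 0 := by
  unfold visitCount at h
  unfold momentScore
  split_ifs with hv
  · simp [hv] at h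
  · rfl

/-- Sums over trajectories are sums over state-action sequences and reward sequences. -/
theorem sum_trajectory (f : Trajectory S A Z H → ℝ) :
    ∑ τ, f τ = ∑ ξ : Fin H → S × A, ∑ r : Fin H → Z, f (mkTrajectory ξ r) := by
  let e : Trajectory S A Z H ≃ (Fin H → S × A) × (Fin H → Z) :=
    { toFun := fun τ => (pairSeq τ, rewardSeq τ)
      invFun := fun p => mkTrajectory p.1 p.2
      left_inv := fun τ => rfl
      right_inv := fun p => rfl }
  rw [← e.symm.sum_comp, Fintype.sum_prod_type]
  rfl

/-- Within a context the rewards at different times are independent, so the sum over reward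
sequences factors; an unspecified time contributes total mass `1`. -/
theorem sum_rewardProb_mul_agree (𝓜 : RMMDP S A Z M) (ξ : Fin H → S × A)
    (o : Fin H → Option Z) :
    ∑ r : Fin H → Z, 𝓜.rewardProb (mkTrajectory ξ r) * agree o r =
      𝓜.moment ξ o := by
  classical
  unfold rewardProb moment agree mkTrajectory
  simp_rw [Finset.sum_mul]
  rw [Finset.sum_comm]
  simp_rw [mul_assoc, ← Finset.mul_sum, ← Finset.prod_mul_distrib]
  refine Finset.sum_congr rfl fun m _ => ?_
  congr 1
  have := Finset.prod_univ_sum (fun _ : Fin H => (Finset.univ : Finset Z))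
    (fun t z => 𝓜.μ m (ξ t).1 (ξ t).2 z * (o t).elim 1 (fun z' => if z = z' then 1 else 0))
  rw [Fintype.piFinset_univ] at this
  rw [← this]
  refine Finset.prod_congr rfl fun t _ => ?_
  cases o t
  · simp [-Finset.univ_eq_attach, 𝓜.μ_sum]
  · simp [-Finset.univ_eq_attach]

theorem sum_rewardProb (𝓜 : RMMDP S A Z M) (ξ : Fin H → S × A) :
    ∑ r : Fin H → Z, 𝓜.rewardProb (mkTrajectory ξ r) = 1 := by
  have := 𝓜.sum_rewardProb_mul_agree ξ (fun _ => none)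
  simpa [agree, moment, 𝓜.w_sum] using this

theorem agree_extend {d : ℕ} (t : Fin d ↪ Fin H) (o : Fin d → Option Z) (r : Fin H → Z) :
    agree (Function.extend t o fun _ => none) r = agree o (r ∘ t) := by
  classical
  unfold agree
  symm
  refine Fintype.prod_of_injective t t.injective _ _ (fun i hi => ?_) fun j => ?_
  · rw [Function.extend_apply' _ _ _ (by simpa using hi)]; rfl
  · rw [t.injective.extend_apply]; rfl

theorem moment_extend (𝓜 : RMMDP S A Z M) {d : ℕ} (t : Fin d ↪ Fin H) (o : Fin d → Option Z)
    (ξ : Fin H → S × A) :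
    𝓜.moment ξ (Function.extend t o fun _ => none) = 𝓜.moment (ξ ∘ t) o := by
  unfold moment
  refine Finset.sum_congr rfl fun m _ => ?_
  congr 1
  symm
  refine Fintype.prod_of_injective t t.injective _ _ (fun i hi => ?_) fun j => ?_
  · rw [Function.extend_apply' _ _ _ (by simpa using hi)]; rfl
  · rw [t.injective.extend_apply]; rfl

/-- Conditionally on the pairs `ξ`, the selected times `hv.times` are fixed, so the agreement
indicator has mean `𝓜.moment x o` and Hoeffding's lemma applies. Choosing the times from `ξ` alone
and a blind policy are both essential. -/
theorem sum_trajProb_mul_exp_momentScore_le (𝓜 : RMMDP S A Z M) (π : List (S × A) → S → A)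
    {d : ℕ} (x : Fin d → S × A) (o : Fin d → Option Z) (l : ℝ) :
    ∑ τ : Trajectory S A Z H, 𝓜.trajProb (fun h s => π (h.map stateAction) s) τ *
      Real.exp (l * 𝓜.momentScore x o (pairSeq τ) (rewardSeq τ) -
        2 * l ^ 2 * visitCount x (pairSeq τ)) ≤ 1 := by
  classical
  simp_rw [trajProb_eq_pair]
  rw [sum_trajectory]
  have h0 := pairKernel_nonneg (π := π) 𝓜.kernel_nonneg
  rw [← sum_seqProb_eq_one h0 (𝓜.sum_pairKernel π) H]
  refine Finset.sum_le_sum fun ξ _ => ?_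
  have hst : ∀ r : Fin H → Z, pairSeq (mkTrajectory ξ r) = ξ := fun r => rfl
  have hrw : ∀ r : Fin H → Z, rewardSeq (mkTrajectory ξ r) = r := fun r => rfl
  simp_rw [hst, hrw, mul_assoc (seqProb _ _)]
  rw [← Finset.mul_sum]
  refine mul_le_of_le_one_right (seqProb_nonneg h0 _) ?_
  by_cases hv : Visits x ξ
  · have hm : 𝓜.moment x o = ∑ r : Fin H → Z,
        𝓜.rewardProb (mkTrajectory ξ r) * agree o (r ∘ hv.times) := by
      simp_rw [← agree_extend]
      rw [sum_rewardProb_mul_agree, moment_extend, hv.comp_times]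
    have key := sum_mul_exp_le
      (fun r : Fin H → Z => 𝓜.rewardProb (mkTrajectory ξ r))
      (fun r => agree o (r ∘ hv.times)) (fun r => 𝓜.rewardProb_nonneg _) (𝓜.sum_rewardProb ξ)
      (fun r => by rw [abs_of_nonneg (agree_nonneg _ _)]; exact agree_le_one _ _) _ hm l
    simp only [momentScore, visitCount, hv, dif_pos, if_pos]
    simp_rw [sub_eq_add_neg _ (2 * l ^ 2 * _), Real.exp_add, ← mul_assoc (𝓜.rewardProb _)]
    rw [← Finset.sum_mul]
    calc _ ≤ Real.exp (2 * l ^ 2) * Real.exp (-(2 * l ^ 2 * (1 : ℕ))) := by gcongr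
      _ = 1 := by rw [← Real.exp_add]; simp
  · simp [momentScore, visitCount, hv, 𝓜.sum_rewardProb]

end

/-! ### Consistent models and the confidence event. -/

section

variable {S A : Type*} {Z : Finset ℝ} {M H : ℕ}

/-- The number of transitions out of `y` in the data `L`. -/
noncomputable def transVisits (y : Option (S × A)) (L : List (Trajectory S A Z H)) : ℕ :=
  (L.map (transCount y)).sum

/-- The number of trajectories of `L` in which the pairs `x` occur. -/
noncomputable def pairVisits {d : ℕ} (x : Fin d → S × A) (L : List (Trajectory S A Z H)) : ℕ :=
  (L.map fun τ => visitCount x (pairSeq τ)).sum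

/-- The policy that ignores the rewards. -/
def blind (π : List (S × A) → S → A) : Policy S A Z := fun h s => π (h.map stateAction) s

variable [Fintype S] [Fintype A]

/-- The model `𝓜` agrees with the data `L` up to statistical fluctuations: the transitions up to
`βT`, the moments of order `d` up to `β`. -/
structure Consistent (P d : ℕ) (β βT : ℝ) (L : List (Trajectory S A Z H))
    (𝓜 : RMMDP S A Z M) : Prop where
  integral : 𝓜.HasIntegralRewards P
  trans : ∀ y b, |(L.map (transScore 𝓜.kernel y b)).sum| ≤ βT * √(transVisits y L : ℕ)
  moments : ∀ (x : Fin d → S × A) (o : Fin d → Option Z),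
    |(L.map fun τ => 𝓜.momentScore x o (pairSeq τ) (rewardSeq τ)).sum| ≤
      β * √(pairVisits x L : ℕ)

open Classical in
/-- The partial reward specifications at `x` that are possible in some context. -/
noncomputable def possible {d : ℕ} (𝓜 : RMMDP S A Z M) (x : Fin d → S × A) :
    Finset (Fin d → Option Z) :=
  Finset.univ.filter fun o => ∃ m, 0 < ∏ j, (o j).elim 1 (𝓜.μ m (x j).1 (x j).2)

theorem sum_prod_elim {ζ : Type*} [Fintype ζ] {d : ℕ} (g : Fin d → ζ → ℝ) :
    ∑ o : Fin d → Option ζ, ∏ j, (o j).elim 1 (g j) = ∏ j, (1 + ∑ z, g j z) := by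
  have := Finset.prod_univ_sum (fun _ : Fin d => (Finset.univ : Finset (Option ζ)))
    (fun j o => o.elim 1 (g j))
  rw [Fintype.piFinset_univ] at this
  rw [← this]
  refine Finset.prod_congr rfl fun j _ => ?_
  rw [Fintype.sum_option]
  rfl

theorem one_le_prod_of_mem_possible {d : ℕ} (𝓜 : RMMDP S A Z M) {P : ℕ} (hP : 1 ≤ P)
    (h𝓜 : 𝓜.HasIntegralRewards P) (x : Fin d → S × A) (o : Fin d → Option Z) (m : Fin M)
    (hm : 0 < ∏ j, (o j).elim 1 (𝓜.μ m (x j).1 (x j).2)) :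
    (1 : ℝ) ≤ ∏ j, (o j).elim 1 (fun z => P * 𝓜.μ m (x j).1 (x j).2 z) := by
  have hP0 : (0 : ℝ) < P := by exact_mod_cast hP
  rw [← Finset.prod_const_one (s := (Finset.univ : Finset (Fin d)))]
  refine Finset.prod_le_prod (fun _ _ => zero_le_one) fun j _ => ?_
  have hj := (Finset.prod_ne_zero_iff.1 hm.ne') j (Finset.mem_univ j)
  revert hj
  cases o j with
  | none => simp
  | some z =>
    intro hj
    obtain ⟨i, -, hi⟩ := h𝓜 m (x j).1 (x j).2 z
    simp only [Option.elim] at hj ⊢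
    rw [hi] at hj ⊢
    rw [mul_div_cancel₀ _ hP0.ne']
    have : i ≠ 0 := by rintro rfl; simp at hj
    exact_mod_cast Nat.one_le_iff_ne_zero.2 this

/-- A positive reward probability is at least `1 / P`, so each possible specification has scaled
weight at least `1`, whereas the weights of one context sum to `(1 + P) ^ d`. The union bound
thereby becomes independent of the number of reward values. -/
theorem card_possible_le {d : ℕ} (𝓜 : RMMDP S A Z M) {P : ℕ}
    (hP : 1 ≤ P) (h𝓜 : 𝓜.HasIntegralRewards P) (x : Fin d → S × A) :
    ((𝓜.possible x).card : ℝ) ≤ M * (1 + P) ^ d := by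
  set W : Fin M → (Fin d → Option Z) → ℝ :=
    fun m o => ∏ j, (o j).elim 1 (fun z => P * 𝓜.μ m (x j).1 (x j).2 z) with hW
  have hnn : ∀ m o, 0 ≤ W m o := by
    intro m o
    refine Finset.prod_nonneg fun j _ => ?_
    cases o j with
    | none => exact zero_le_one
    | some z => exact mul_nonneg (Nat.cast_nonneg _) (𝓜.μ_nonneg _ _ _ _)
  have hone : ∀ o ∈ 𝓜.possible x, (1 : ℝ) ≤ ∑ m, W m o := by
    intro o ho
    obtain ⟨m, hm⟩ := (Finset.mem_filter.1 ho).2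
    exact (𝓜.one_le_prod_of_mem_possible hP h𝓜 x o m hm).trans
      (Finset.single_le_sum (f := fun m => W m o) (fun m _ => hnn m o) (Finset.mem_univ m))
  calc ((𝓜.possible x).card : ℝ) = ∑ _o ∈ 𝓜.possible x, (1 : ℝ) := by simp
    _ ≤ ∑ o ∈ 𝓜.possible x, ∑ m, W m o := Finset.sum_le_sum hone
    _ ≤ ∑ o, ∑ m, W m o :=
        Finset.sum_le_sum_of_subset_of_nonneg (Finset.subset_univ _) fun o _ _ =>
          Finset.sum_nonneg fun m _ => hnn m o
    _ = ∑ m : Fin M, ∏ _j : Fin d, (1 + P : ℝ) := by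
        rw [Finset.sum_comm]
        refine Finset.sum_congr rfl fun m _ => ?_
        rw [hW, sum_prod_elim]
        refine Finset.prod_congr rfl fun j _ => ?_
        rw [← Finset.mul_sum, 𝓜.μ_sum, mul_one]
    _ = _ := by simp

/-- An impossible specification has moment `0` and is never observed, so it needs no concentration
bound. -/
theorem momentScore_eq_zero_of_notMem_possible (𝓜 : RMMDP S A Z M) {d : ℕ}
    (x : Fin d → S × A) (o : Fin d → Option Z) (ho : o ∉ 𝓜.possible x) (π : Policy S A Z)
    (τ : Trajectory S A Z H) (hτ : 0 < 𝓜.trajProb π τ) :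
    𝓜.momentScore x o (pairSeq τ) (rewardSeq τ) = 0 := by
  classical
  have hz : ∀ m, ∏ j, (o j).elim 1 (𝓜.μ m (x j).1 (x j).2) = 0 := by
    intro m
    by_contra hne
    refine ho (Finset.mem_filter.2 ⟨Finset.mem_univ _, m, lt_of_le_of_ne ?_ (Ne.symm hne)⟩)
    exact Finset.prod_nonneg fun _ _ => 𝓜.elim_nonneg _ _ _
  unfold momentScore
  split_ifs with hv
  · have h1 : 𝓜.moment x o = 0 := by simp [moment, hz]
    have h2 : 𝓜.rewardProb τ ≠ 0 := by
      intro h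
      simp [trajProb, h] at hτ
    obtain ⟨m, -, hm⟩ := Finset.exists_ne_zero_of_sum_ne_zero h2
    have hμ := Finset.prod_ne_zero_iff.1 (right_ne_zero_of_mul hm)
    rw [h1, sub_zero]
    obtain ⟨j, -, hj⟩ := Finset.prod_eq_zero_iff.1 (hz m)
    refine Finset.prod_eq_zero (Finset.mem_univ j) ?_
    revert hj
    cases o j with
    | none => simp
    | some z =>
      simp only [Option.elim]
      intro hj
      rw [if_neg]
      intro hr
      refine hμ (hv.times j) (Finset.mem_univ _) ?_
      have hx : pairSeq τ (hv.times j) = x j := congrFun hv.comp_times j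
      have hx1 : (τ (hv.times j)).1 = (x j).1 := congrArg Prod.fst hx
      have hx2 : (τ (hv.times j)).2.1 = (x j).2 := congrArg Prod.snd hx
      rw [hx1, hx2, ← hj, ← hr]
      rfl
  · rfl

/-- With high probability the true model is consistent with all prefixes of the data. -/
theorem seqMeas_not_consistent_le (𝓜 : RMMDP S A Z M) {P : ℕ} (hP : 1 ≤ P)
    (h𝓜 : 𝓜.HasIntegralRewards P) (d N : ℕ)
    (explore : List (Trajectory S A Z H) → List (S × A) → S → A) (β βT : ℝ) (hβ : 0 ≤ β)
    (hβT : 0 ≤ βT) :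
    seqMeas (fun L => 𝓜.trajProb (blind (explore L))) N
      (fun D => ∃ k ≤ N, ¬ 𝓜.Consistent P d β βT ((List.ofFn D).take k)) ≤
      (Fintype.card S * Fintype.card A + 1) * 2 ^ Fintype.card S *
        (N * (N * H) * (2 * Real.exp (-(βT ^ 2 / 8)))) +
      (Fintype.card S * Fintype.card A) ^ d * (M * (1 + P) ^ d) *
        (N * N * (2 * Real.exp (-(β ^ 2 / 8)))) := by
  classical
  set K : List (Trajectory S A Z H) → Trajectory S A Z H → ℝ :=
    fun L => 𝓜.trajProb (blind (explore L)) with hKdef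
  have hK : ∀ L τ, 0 ≤ K L τ := fun L τ => 𝓜.trajProb_nonneg _ τ
  have hK1 : ∀ L, ∑ τ, K L τ = 1 := fun L => 𝓜.sum_trajProb _
  -- One event per sign pattern of the next states: these `2 ^ |S|` signed means jointly control the
  -- `ℓ¹` error of the kernel.
  set E : Option (S × A) × (S → Bool) → (Fin N → Trajectory S A Z H) → Prop := fun i D =>
    ∃ k ≤ N, βT * √((((List.ofFn D).take k).map (transCount i.1)).sum : ℕ) <
      |(((List.ofFn D).take k).map (transScore 𝓜.kernel i.1 i.2)).sum|
  set F : (Σ _ : Fin d → S × A, Fin d → Option Z) → (Fin N → Trajectory S A Z H) → Prop :=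
    fun i D =>
    ∃ k ≤ N, β * √((((List.ofFn D).take k).map fun τ => visitCount i.1 (pairSeq τ)).sum : ℕ) <
      |(((List.ofFn D).take k).map fun τ =>
        𝓜.momentScore i.1 i.2 (pairSeq τ) (rewardSeq τ)).sum|
  set I : Finset (Σ _ : Fin d → S × A, Fin d → Option Z) :=
    Finset.univ.sigma fun x => 𝓜.possible x
  have hsub : ∀ D, 0 < seqProb K D →
      (∃ k ≤ N, ¬ 𝓜.Consistent P d β βT ((List.ofFn D).take k)) →
      (∃ i ∈ Finset.univ, E i D) ∨ (∃ i ∈ I, F i D) := by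
    rintro D hD ⟨k, hk, hcon⟩
    by_contra hno
    push Not at hno
    obtain ⟨h1, h2⟩ := hno
    refine hcon ⟨h𝓜, fun y b => ?_, fun x o => ?_⟩
    · have := h1 (y, b) (Finset.mem_univ _)
      simp only [E, not_exists, not_and, not_lt] at this
      exact this k hk
    · by_cases ho : o ∈ 𝓜.possible x
      · have := h2 ⟨x, o⟩ (by simp [I, ho])
        simp only [F, not_exists, not_and, not_lt] at this
        exact this k hk
      · rw [List.sum_eq_zero]
        · simp only [abs_zero]; positivity
        · intro v hv
          obtain ⟨τ, hτ, rfl⟩ := List.mem_map.1 hv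
          obtain ⟨i, rfl⟩ := List.mem_ofFn.1 (List.mem_of_mem_take hτ)
          have hpos : 0 < K ((List.ofFn D).take i) (D i) := by
            refine lt_of_le_of_ne (hK _ _) (Ne.symm ?_)
            exact Finset.prod_ne_zero_iff.1 hD.ne' i (Finset.mem_univ i)
          exact 𝓜.momentScore_eq_zero_of_notMem_possible x o ho _ _ hpos
  refine (seqMeas_mono hK hsub).trans ((seqMeas_or_le hK _ _).trans (add_le_add ?_ ?_))
  · refine (seqMeas_exists_le hK _ _).trans ?_
    calc _ ≤ ∑ _i : Option (S × A) × (S → Bool),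
          (N : ℝ) * (N * H) * (2 * Real.exp (-(βT ^ 2 / 8))) := by
          refine Finset.sum_le_sum fun i _ => ?_
          exact seqMeas_deviation_le hK hK1 (transCount i.1) H (transCount_le i.1) _
            (transScore_eq_zero _ _ _)
            (fun L l => 𝓜.sum_trajProb_mul_exp_transScore_le _ i.1 i.2 l) βT hβT
      _ = _ := by simp
  · refine (seqMeas_exists_le hK _ _).trans ?_
    calc _ ≤ ∑ _i ∈ I, (N : ℝ) * N * (2 * Real.exp (-(β ^ 2 / 8))) := by
          refine Finset.sum_le_sum fun i _ => ?_
          have := seqMeas_deviation_le (N := N) hK hK1 (fun τ => visitCount i.1 (pairSeq τ)) 1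
            (fun τ => visitCount_le _ _)
            (fun τ => 𝓜.momentScore i.1 i.2 (pairSeq τ) (rewardSeq τ))
            (fun τ => 𝓜.momentScore_eq_zero _ _ _ _)
            (fun L l => 𝓜.sum_trajProb_mul_exp_momentScore_le _ i.1 i.2 l) β hβ
          rwa [Nat.cast_one, mul_one] at this
      _ = I.card * ((N : ℝ) * N * (2 * Real.exp (-(β ^ 2 / 8)))) := by simp
      _ ≤ _ := by
          refine mul_le_mul_of_nonneg_right ?_ (by positivity)
          rw [Finset.card_sigma, Nat.cast_sum]
          calc _ ≤ ∑ _x : Fin d → S × A, (M : ℝ) * (1 + P) ^ d := by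
                refine Finset.sum_le_sum fun x _ => ?_
                exact 𝓜.card_possible_le hP h𝓜 x
            _ = _ := by simp

/-! ### Consequences of consistency -/

/-- Two models that fit the same data up to `γ √n` differ by at most `4 γ / √(n + 1)`. -/
theorem abs_sub_le_of_fit {u v γ : ℝ} (n : ℕ) (hγ : 1 ≤ γ) (h2 : |u - v| ≤ 2)
    (h : n * |u - v| ≤ 2 * γ * √n) : |u - v| ≤ 4 * γ * (1 / √((n : ℝ) + 1)) := by
  rcases Nat.eq_zero_or_pos n with rfl | hn
  · simp; linarith
  have hn1 : (1 : ℝ) ≤ n := by exact_mod_cast hn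
  have h0 : 0 < √(n : ℝ) := Real.sqrt_pos.2 (by linarith)
  have hs := Real.mul_self_sqrt (show (0 : ℝ) ≤ n by linarith)
  have h1 : 0 < √((n : ℝ) + 1) := Real.sqrt_pos.2 (by linarith)
  have h3 : √((n : ℝ) + 1) ≤ 2 * √n := by
    rw [Real.sqrt_le_left (by positivity), mul_pow, Real.sq_sqrt (by linarith)]
    linarith
  have h4 : √(n : ℝ) * |u - v| ≤ 2 * γ := by
    refine le_of_mul_le_mul_left ?_ h0
    calc √(n : ℝ) * (√n * |u - v|) = n * |u - v| := by rw [← mul_assoc, hs]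
      _ ≤ _ := h
      _ = _ := by ring
  rw [mul_one_div, le_div_iff₀ h1]
  have := abs_nonneg (u - v)
  nlinarith

theorem sum_map_sub_sum_map {α : Type*} (L : List α) (f g : α → ℝ) :
    (L.map f).sum - (L.map g).sum = (L.map fun a => f a - g a).sum := by
  induction L with
  | nil => simp
  | cons a L ih => simp only [List.map_cons, List.sum_cons, ← ih]; ring

theorem sum_map_natCast_mul {α : Type*} (L : List α) (f : α → ℕ) (c : ℝ) :
    (L.map fun a => (f a : ℝ) * c).sum = ((L.map f).sum : ℕ) * c := by
  induction L with
  | nil => simp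
  | cons a L ih => simp only [List.map_cons, List.sum_cons, ih]; push_cast; ring

variable {P d : ℕ} {β βT : ℝ} {L : List (Trajectory S A Z H)} {𝓜 𝓜' : RMMDP S A Z M}

/-- With `b` the sign pattern of the difference, the `ℓ¹` distance is a single signed mean. The
observed next states cancel between the scores of the two models, leaving the count times that
difference. -/
theorem Consistent.kernel_sub_le (hβT : 1 ≤ βT) (h : 𝓜.Consistent P d β βT L)
    (h' : 𝓜'.Consistent P d β βT L) (y : Option (S × A)) :
    ∑ s, |𝓜.kernel y s - 𝓜'.kernel y s| ≤
      4 * βT * (1 / √((transVisits y L : ℝ) + 1)) := by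
  classical
  set b : S → Bool := fun s => decide (𝓜'.kernel y s ≤ 𝓜.kernel y s) with hb
  set u := ∑ s, 𝓜.kernel y s * signOf (b s)
  set v := ∑ s, 𝓜'.kernel y s * signOf (b s)
  have huv : u - v = ∑ s, |𝓜.kernel y s - 𝓜'.kernel y s| := by
    rw [← Finset.sum_sub_distrib]
    refine Finset.sum_congr rfl fun s _ => ?_
    by_cases hs : 𝓜'.kernel y s ≤ 𝓜.kernel y s
    · simp [hb, signOf, hs, abs_of_nonneg (sub_nonneg.2 hs)]
    · simp only [hb, signOf, hs, decide_false, Bool.false_eq_true, if_false]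
      rw [abs_of_neg (sub_neg.2 (not_le.1 hs))]; ring
  have h0 : 0 ≤ u - v := huv ▸ Finset.sum_nonneg fun _ _ => abs_nonneg _
  have h2 : u - v ≤ 2 := by
    rw [huv]
    calc _ ≤ ∑ s, (𝓜.kernel y s + 𝓜'.kernel y s) := by
          refine Finset.sum_le_sum fun s _ => ?_
          have h1 := 𝓜.kernel_nonneg y s
          have h2 := 𝓜'.kernel_nonneg y s
          rw [abs_le]; constructor <;> linarith
      _ = 2 := by rw [Finset.sum_add_distrib, kernel_sum, kernel_sum]; norm_num
  rw [← huv, ← abs_of_nonneg h0]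
  refine abs_sub_le_of_fit _ hβT (by rwa [abs_of_nonneg h0]) ?_
  have e1 := h.trans y b
  have e2 := h'.trans y b
  have e3 : (L.map (transScore 𝓜'.kernel y b)).sum - (L.map (transScore 𝓜.kernel y b)).sum =
      (transVisits y L : ℕ) * (u - v) := by
    rw [sum_map_sub_sum_map, transVisits, ← sum_map_natCast_mul]
    congr 1
    refine List.map_congr_left fun τ _ => ?_
    unfold transScore transCount
    rw [← Finset.sum_sub_distrib, Finset.card_filter, Nat.cast_sum, Finset.sum_mul]
    refine Finset.sum_congr rfl fun t _ => ?_
    split_ifs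
    · simp only [u, v]; push_cast; ring
    · simp
  rw [abs_of_nonneg h0, ← e3]
  have := abs_le.1 e1
  have := abs_le.1 e2
  linarith

/-- The empirical indicators cancel between the two scores, leaving the number of visits times the
difference of the moments. -/
theorem Consistent.moment_sub_le (hβ : 1 ≤ β) (h : 𝓜.Consistent P d β βT L)
    (h' : 𝓜'.Consistent P d β βT L) (x : Fin d → S × A) (o : Fin d → Option Z) :
    |𝓜.moment x o - 𝓜'.moment x o| ≤ 4 * β * (1 / √((pairVisits x L : ℝ) + 1)) := by
  classical
  refine abs_sub_le_of_fit _ hβ ?_ ?_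
  · have := 𝓜.moment_nonneg x o
    have := 𝓜'.moment_nonneg x o
    have := 𝓜.moment_le_one x o
    have := 𝓜'.moment_le_one x o
    rw [abs_le]; constructor <;> linarith
  have e1 := h.moments x o
  have e2 := h'.moments x o
  have e3 : (L.map fun τ => 𝓜'.momentScore x o (pairSeq τ) (rewardSeq τ)).sum -
      (L.map fun τ => 𝓜.momentScore x o (pairSeq τ) (rewardSeq τ)).sum =
      (pairVisits x L : ℕ) * (𝓜.moment x o - 𝓜'.moment x o) := by
    rw [sum_map_sub_sum_map, pairVisits, ← sum_map_natCast_mul]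
    congr 1
    refine List.map_congr_left fun τ _ => ?_
    unfold momentScore visitCount
    split_ifs <;> simp
  have : (pairVisits x L : ℝ) * |𝓜.moment x o - 𝓜'.moment x o| =
      |(L.map fun τ => 𝓜'.momentScore x o (pairSeq τ) (rewardSeq τ)).sum -
      (L.map fun τ => 𝓜.momentScore x o (pairSeq τ) (rewardSeq τ)).sum| := by
    rw [e3, abs_mul, Nat.abs_cast]
  rw [this]
  refine (abs_sub _ _).trans ?_
  linarith

end

end RMMDP

/-! ### Optimistic planning for exploration. -/

/-- The expectation of the terminal value `F` of `n` more steps of the kernel `K`. -/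
noncomputable def expVal {α : Type*} [Fintype α] (K : List α → α → ℝ) (F : List α → ℝ) :
    ℕ → List α → ℝ
  | 0, h => F h
  | n + 1, h => ∑ a, K h a * expVal K F n (h ++ [a])

theorem sum_seqProb_mul_eq_expVal {α : Type*} [Fintype α] {K : List α → α → ℝ}
    (hK : ∀ h a, 0 ≤ K h a) (F : List α → ℝ) (N : ℕ) :
    ∑ D : Fin N → α, seqProb K D * F (List.ofFn D) = expVal K F N [] := by
  set G : List α → ℝ := fun h => expVal K F (N - h.length) h
  have hG : ∀ h : List α, h.length < N → ∑ a, K h a * G (h ++ [a]) = G h := by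
    intro h hh
    obtain ⟨n, hn⟩ : ∃ n, N - h.length = n + 1 := ⟨N - h.length - 1, by omega⟩
    have hn' : ∀ a, N - (h ++ [a]).length = n := fun a => by
      simp only [List.length_append, List.length_singleton]; omega
    simp only [G, hn, hn', expVal]
  have h1 := sum_seqProb_mul_le hK G N fun h hh => (hG h hh).le
  have h2 := le_sum_seqProb_mul hK G N fun h hh => (hG h hh).ge
  have h3 : ∀ D : Fin N → α, G (List.ofFn D) = F (List.ofFn D) := fun D => by
    simp [G, expVal]
  simp_rw [h3] at h1 h2
  exact le_antisymm h1 h2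

namespace RMMDP

section

variable {S A : Type*} [Fintype S] [Fintype A]

/-- The optimistic value of exploration: an upper bound, under the kernel `p`, for the expected
terminal uncertainty `u` plus the accumulated transition uncertainties `e`, clipped at `1`. -/
noncomputable def planVal (p : Option (S × A) → S → ℝ) (e : Option (S × A) → ℝ)
    (u : List (S × A) → ℝ) : ℕ → List (S × A) → ℝ
  | 0, h => u h
  | n + 1, h => min 1 (e h.getLast? + ∑ s, p h.getLast? s * ⨆ a, planVal p e u n (h ++ [(s, a)]))

variable {p q : Option (S × A) → S → ℝ} {e : Option (S × A) → ℝ} {u : List (S × A) → ℝ}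

theorem planVal_le_one (hu : ∀ h, u h ≤ 1) (n : ℕ) (h : List (S × A)) :
    planVal p e u n h ≤ 1 := by
  cases n
  · exact hu h
  · exact min_le_left _ _

theorem le_iSup_planVal (n : ℕ) (h : List (S × A)) (s : S) (a : A) :
    planVal p e u n (h ++ [(s, a)]) ≤ ⨆ a, planVal p e u n (h ++ [(s, a)]) :=
  le_ciSup (f := fun a => planVal p e u n (h ++ [(s, a)])) (Set.finite_range _).bddAbove a

theorem planVal_nonneg (hp : ∀ y s, 0 ≤ p y s) (he : ∀ y, 0 ≤ e y) (hu : ∀ h, 0 ≤ u h)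
    (n : ℕ) (h : List (S × A)) : 0 ≤ planVal p e u n h := by
  induction n generalizing h with
  | zero => exact hu h
  | succ n ih =>
    refine le_min zero_le_one (add_nonneg (he _) (Finset.sum_nonneg fun s _ => ?_))
    exact mul_nonneg (hp _ _) (Real.iSup_nonneg fun a => ih _)

variable [Nonempty A]

theorem exists_planVal_eq_iSup (p : Option (S × A) → S → ℝ) (e : Option (S × A) → ℝ)
    (u : List (S × A) → ℝ) (n : ℕ) (h : List (S × A)) (s : S) :
    ∃ a, planVal p e u n (h ++ [(s, a)]) = ⨆ a, planVal p e u n (h ++ [(s, a)]) :=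
  exists_eq_ciSup_of_finite

/-- The policy that is greedy for `planVal` in an episode of length `H`. -/
noncomputable def greedy (p : Option (S × A) → S → ℝ) (e : Option (S × A) → ℝ)
    (u : List (S × A) → ℝ) (H : ℕ) (h : List (S × A)) (s : S) : A :=
  (exists_planVal_eq_iSup p e u (H - h.length - 1) h s).choose

theorem iSup_planVal_nonneg (hp : ∀ y s, 0 ≤ p y s) (he : ∀ y, 0 ≤ e y) (hu : ∀ h, 0 ≤ u h)
    (n : ℕ) (h : List (S × A)) (s : S) : 0 ≤ ⨆ a, planVal p e u n (h ++ [(s, a)]) :=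
  Real.iSup_nonneg fun _ => planVal_nonneg hp he hu _ _

theorem iSup_planVal_le_one (hu : ∀ h, u h ≤ 1) (n : ℕ) (h : List (S × A)) (s : S) :
    ⨆ a, planVal p e u n (h ++ [(s, a)]) ≤ 1 :=
  ciSup_le fun _ => planVal_le_one hu _ _

/-- Changing the kernel changes the mean of a function with values in `[-1, 1]` by at most `ε`. -/
theorem abs_sum_mul_sub_le {f : S → ℝ} (hf : ∀ s, |f s| ≤ 1) {y : Option (S × A)} {ε : ℝ}
    (hpq : ∑ s, |q y s - p y s| ≤ ε) : |∑ s, q y s * f s - ∑ s, p y s * f s| ≤ ε := by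
  rw [← Finset.sum_sub_distrib]
  refine (Finset.abs_sum_le_sum_abs _ _).trans (le_trans (Finset.sum_le_sum fun s _ => ?_) hpq)
  rw [← sub_mul, abs_mul]
  exact mul_le_of_le_one_right (abs_nonneg _) (hf s)

variable {Z : Finset ℝ}

/-- Backward induction: replacing `q` by `p` costs at most `e`, since the continuation values lie in
`[0, 1]`, and clipping at `1` loses nothing for the same reason. -/
theorem expVal_le_planVal {g : S → A → Z → ℝ} (hg1 : ∀ s a, ∑ z, g s a z = 1)
    (hg : ∀ s a z, 0 ≤ g s a z) (hq : ∀ y s, 0 ≤ q y s) (hq1 : ∀ y, ∑ s, q y s = 1)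
    (hp : ∀ y s, 0 ≤ p y s)
    (he : ∀ y, 0 ≤ e y) (hpq : ∀ y, ∑ s, |q y s - p y s| ≤ e y)
    (hu0 : ∀ h, 0 ≤ u h) (hu1 : ∀ h, u h ≤ 1) (π : Policy S A Z) (n : ℕ)
    (h : List (S × A × Z)) :
    expVal (stepKernel q π g) (fun h => u (h.map stateAction)) n h ≤
      planVal p e u n (h.map stateAction) := by
  induction n generalizing h with
  | zero => exact le_rfl
  | succ n ih =>
    set f : S → ℝ := fun s => ⨆ a, planVal p e u n (h.map stateAction ++ [(s, a)]) with hf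
    have hf1 : ∀ s, f s ≤ 1 := fun s => iSup_planVal_le_one hu1 _ _ _
    have hf0 : ∀ s, 0 ≤ f s := fun s => iSup_planVal_nonneg hp he hu0 _ _ _
    have hstep : expVal (stepKernel q π g) (fun h => u (h.map stateAction)) (n + 1) h ≤
        ∑ s, q (lastPair h) s * f s := by
      simp only [expVal]
      rw [sum_stepKernel_mul]
      refine Finset.sum_le_sum fun s _ => mul_le_mul_of_nonneg_left ?_ (hq _ _)
      rw [← one_mul (f s), ← hg1 s (π h s), Finset.sum_mul]
      refine Finset.sum_le_sum fun z _ => mul_le_mul_of_nonneg_left ?_ (hg _ _ _)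
      refine (ih _).trans ?_
      rw [List.map_append]
      exact le_iSup_planVal n _ s (π h s)
    refine hstep.trans (le_min ?_ ?_)
    · rw [← hq1 (lastPair h)]
      exact Finset.sum_le_sum fun s _ => mul_le_of_le_one_right (hq _ _) (hf1 s)
    · have := (abs_le.1 (abs_sum_mul_sub_le (fun s => abs_le.2 ⟨by linarith [hf0 s], hf1 s⟩)
        (hpq (lastPair h)))).2
      have h2 : e (lastPair h) + ∑ s, p (lastPair h) s * f s =
          e (h.map stateAction).getLast? + ∑ s, p (h.map stateAction).getLast? s * f s := rfl
      linarith

theorem abs_expVal_le_one {g : S → A → Z → ℝ} (hg1 : ∀ s a, ∑ z, g s a z = 1)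
    (hg : ∀ s a z, 0 ≤ g s a z) (hq : ∀ y s, 0 ≤ q y s) (hq1 : ∀ y, ∑ s, q y s = 1)
    {F : List (S × A × Z) → ℝ} (hF : ∀ h, |F h| ≤ 1) (π : Policy S A Z) (n : ℕ)
    (h : List (S × A × Z)) : |expVal (stepKernel q π g) F n h| ≤ 1 := by
  induction n generalizing h with
  | zero => exact hF h
  | succ n ih =>
    simp only [expVal]
    refine (Finset.abs_sum_le_sum_abs _ _).trans ?_
    calc _ ≤ ∑ a, stepKernel q π g h a * 1 := by
          refine Finset.sum_le_sum fun a _ => ?_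
          rw [abs_mul, abs_of_nonneg (stepKernel_nonneg hq hg h a)]
          exact mul_le_mul_of_nonneg_left (ih _) (stepKernel_nonneg hq hg h a)
      _ = 1 := by
          rw [sum_stepKernel_mul q π g h (fun _ => 1)]
          simp_rw [mul_one, hg1, mul_one, hq1]

/-- A simulation lemma. The transition errors along the episode are already paid for by the bonuses
`e`; the factor `2` is needed because the difference can reach `2` where `planVal` is clipped at
`1`. -/
theorem abs_expVal_sub_le {g : S → A → Z → ℝ} (hg1 : ∀ s a, ∑ z, g s a z = 1)
    (hg : ∀ s a z, 0 ≤ g s a z) (hq : ∀ y s, 0 ≤ q y s) (hq1 : ∀ y, ∑ s, q y s = 1)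
    (hp : ∀ y s, 0 ≤ p y s) (hp1 : ∀ y, ∑ s, p y s = 1)
    (he : ∀ y, 0 ≤ e y) (hpq : ∀ y, ∑ s, |q y s - p y s| ≤ e y)
    (hu0 : ∀ h, 0 ≤ u h)
    {F : List (S × A × Z) → ℝ} (hF : ∀ h, |F h| ≤ 1) (π : Policy S A Z) (n : ℕ)
    (h : List (S × A × Z)) :
    |expVal (stepKernel q π g) F n h - expVal (stepKernel p π g) F n h| ≤
      2 * planVal p e u n (h.map stateAction) := by
  induction n generalizing h with
  | zero => simpa [expVal, planVal] using hu0 _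
  | succ n ih =>
    set f : S → ℝ := fun s => ⨆ a, planVal p e u n (h.map stateAction ++ [(s, a)]) with hf
    have h1 := abs_expVal_le_one hg1 hg hq hq1 hF π (n + 1) h
    have h2 := abs_expVal_le_one hg1 hg hp hp1 hF π (n + 1) h
    set a : S → ℝ := fun s => ∑ z, g s (π h s) z *
      expVal (stepKernel q π g) F n (h ++ [(s, π h s, z)]) with ha
    set b : S → ℝ := fun s => ∑ z, g s (π h s) z *
      expVal (stepKernel p π g) F n (h ++ [(s, π h s, z)]) with hb
    have ha1 : ∀ s, |a s| ≤ 1 := by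
      intro s
      refine (Finset.abs_sum_le_sum_abs _ _).trans ?_
      rw [← hg1 s (π h s)]
      refine Finset.sum_le_sum fun z _ => ?_
      rw [abs_mul, abs_of_nonneg (hg _ _ _)]
      exact mul_le_of_le_one_right (hg _ _ _) (abs_expVal_le_one hg1 hg hq hq1 hF π n _)
    have hab : ∀ s, |a s - b s| ≤ 2 * f s := by
      intro s
      rw [ha, hb, ← Finset.sum_sub_distrib]
      refine (Finset.abs_sum_le_sum_abs _ _).trans ?_
      rw [← one_mul (2 * f s), ← hg1 s (π h s), Finset.sum_mul]
      refine Finset.sum_le_sum fun z _ => ?_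
      rw [← mul_sub, abs_mul, abs_of_nonneg (hg _ _ _)]
      refine mul_le_mul_of_nonneg_left ((ih _).trans ?_) (hg _ _ _)
      rw [List.map_append]
      exact mul_le_mul_of_nonneg_left (le_iSup_planVal n _ s (π h s)) zero_le_two
    have hq' : expVal (stepKernel q π g) F (n + 1) h = ∑ s, q (lastPair h) s * a s := by
      simp only [expVal]; rw [sum_stepKernel_mul]
    have hp' : expVal (stepKernel p π g) F (n + 1) h = ∑ s, p (lastPair h) s * b s := by
      simp only [expVal]; rw [sum_stepKernel_mul]
    have hV : planVal p e u (n + 1) (h.map stateAction) =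
      min 1 (e (lastPair h) + ∑ s, p (lastPair h) s * f s) := rfl
    rw [hV, mul_min_of_nonneg _ _ zero_le_two]
    refine le_min ?_ ?_
    · refine (abs_sub _ _).trans ?_
      linarith
    · rw [hq', hp']
      have e1 := abs_sum_mul_sub_le ha1 (hpq (lastPair h))
      have e2 : |∑ s, p (lastPair h) s * a s - ∑ s, p (lastPair h) s * b s| ≤
          2 * ∑ s, p (lastPair h) s * f s := by
        rw [← Finset.sum_sub_distrib, Finset.mul_sum]
        refine (Finset.abs_sum_le_sum_abs _ _).trans (Finset.sum_le_sum fun s _ => ?_)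
        rw [← mul_sub, abs_mul, abs_of_nonneg (hp _ _)]
        calc _ ≤ p (lastPair h) s * (2 * f s) := mul_le_mul_of_nonneg_left (hab s) (hp _ _)
          _ = _ := by ring
      have e3 := abs_sub_le (∑ s, q (lastPair h) s * a s) (∑ s, p (lastPair h) s * a s)
        (∑ s, p (lastPair h) s * b s)
      have := he (lastPair h)
      linarith

/-- The greedy policy collects, in the true model, at least half the optimistic value. -/
theorem planVal_le_sum_seqProb {g : S → A → Z → ℝ} (hg1 : ∀ s a, ∑ z, g s a z = 1)
    (hg : ∀ s a z, 0 ≤ g s a z) (hq : ∀ y s, 0 ≤ q y s) (hq1 : ∀ y, ∑ s, q y s = 1)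
    (hp : ∀ y s, 0 ≤ p y s) (he : ∀ y, 0 ≤ e y) (hpq : ∀ y, ∑ s, |q y s - p y s| ≤ e y)
    (hu0 : ∀ h, 0 ≤ u h) (hu1 : ∀ h, u h ≤ 1) (H : ℕ) :
    planVal p e u H [] ≤ ∑ τ : Trajectory S A Z H,
      seqProb (stepKernel q (blind (greedy p e u H)) g) τ *
        (u (List.ofFn (pairSeq τ)) + 2 * ∑ t, min 1 (e (prevPair τ t))) := by
  set c : Option (S × A) → ℝ := fun y => min 1 (e y) with hc
  set acc : List (S × A × Z) → ℝ := fun h =>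
    ∑ i ∈ Finset.range h.length, c (lastPair (h.take i)) with hacc
  have hacc_snoc : ∀ h a, acc (h ++ [a]) = acc h + c (lastPair h) := by
    intro h a
    simp only [hacc, List.length_append, List.length_singleton, Finset.sum_range_succ]
    rw [List.take_append_of_le_length le_rfl, List.take_length]
    congr 1
    refine Finset.sum_congr rfl fun i hi => ?_
    rw [List.take_append_of_le_length (Finset.mem_range.1 hi).le]
  -- Twice the clipped bonuses so far plus the remaining optimistic value does not decrease in
  -- expectation under the greedy policy.
  set G : List (S × A × Z) → ℝ := fun h =>
    2 * acc h + planVal p e u (H - h.length) (h.map stateAction) with hG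
  have key := le_sum_seqProb_mul
    (stepKernel_nonneg (π := blind (greedy p e u H)) hq hg) G H (by
    intro h hh
    obtain ⟨n, hn⟩ : ∃ n, H - h.length = n + 1 := ⟨H - h.length - 1, by omega⟩
    have hn' : ∀ a, H - (h ++ [a]).length = n := fun a => by
      simp only [List.length_append, List.length_singleton]; omega
    set f : S → ℝ := fun s => ⨆ a, planVal p e u n (h.map stateAction ++ [(s, a)]) with hf
    have hf1 : ∀ s, f s ≤ 1 := fun s => iSup_planVal_le_one hu1 _ _ _
    have hf0 : ∀ s, 0 ≤ f s := fun s => iSup_planVal_nonneg hp he hu0 _ _ _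
    have hgr : ∀ s, planVal p e u n
        (h.map stateAction ++ [(s, greedy p e u H (h.map stateAction) s)]) = f s := by
      intro s
      have := (exists_planVal_eq_iSup p e u
        (H - (h.map stateAction).length - 1) (h.map stateAction) s).choose_spec
      have hlen : H - (h.map stateAction).length - 1 = n := by
        rw [List.length_map]; omega
      simp only [greedy, hlen] at this ⊢
      exact this
    have hGs : ∀ s z, G (h ++ [(s, blind (greedy p e u H) h s, z)]) =
        2 * acc h + 2 * c (lastPair h) + f s := by
      intro s z
      simp only [hG]
      rw [hn', hacc_snoc, List.map_append]
      have := hgr s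
      simp only [List.map_cons, List.map_nil]
      rw [show stateAction (s, blind (greedy p e u H) h s, z)
        = (s, greedy p e u H (h.map stateAction) s) from rfl, this]
      ring
    rw [sum_stepKernel_mul]
    simp_rw [hGs, ← Finset.sum_mul, hg1, one_mul, mul_add, Finset.sum_add_distrib,
      ← Finset.sum_mul, hq1, one_mul]
    simp only [hG, hn]
    have hV : planVal p e u (n + 1) (h.map stateAction) =
      min 1 (e (lastPair h) + ∑ s, p (lastPair h) s * f s) := rfl
    have hq0 : 0 ≤ ∑ s, q (lastPair h) s * f s :=
      Finset.sum_nonneg fun s _ => mul_nonneg (hq _ _) (hf0 s)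
    have h3 := (abs_le.1 (abs_sum_mul_sub_le
      (fun s => abs_le.2 ⟨by linarith [hf0 s], hf1 s⟩) (hpq (lastPair h)))).1
    rw [hV]
    -- One `e` pays for the bonus and one for the change of kernel; if `e ≥ 1`, the clip at `1`
    -- already suffices.
    have h4 : min 1 (e (lastPair h) + ∑ s, p (lastPair h) s * f s) ≤
        2 * c (lastPair h) + ∑ s, q (lastPair h) s * f s := by
      simp only [hc]
      rcases le_total 1 (e (lastPair h)) with h5 | h5
      · rw [min_eq_left h5]
        exact (min_le_left _ _).trans (by linarith)
      · rw [min_eq_right h5]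
        exact (min_le_right _ _).trans (by linarith)
    linarith)
  have h0 : G [] = planVal p e u H [] := by simp [hG, hacc]
  rw [h0] at key
  refine key.trans (le_of_eq (Finset.sum_congr rfl fun τ _ => ?_))
  congr 1
  simp only [hG, hacc, List.length_ofFn, Nat.sub_self, planVal]
  rw [Finset.sum_range, add_comm, List.map_ofFn]
  rfl

end

/-! ### From moments to reward laws and values. -/

section

variable {S A : Type*} [Fintype S] [Fintype A] {Z : Finset ℝ} {M H : ℕ}

/-- The constant of the comparison of `M`-fold mixtures through moments of degree `d`. -/
noncomputable def mixtureConst (M P d : ℕ) : ℝ :=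
  (2 * M : ℕ) * ((2 * M).factorial : ℝ) * (P : ℝ) ^ (d * (2 * M + 1))

/-- The reward laws of two models are close if their moments of degree `d` are. -/
theorem abs_rewardProb_sub_le (𝓜 𝓜' : RMMDP S A Z M) {P d : ℕ} (hP : 1 ≤ P) (hdH : d ≤ H)
    (hd : 2 * M * P ^ d < 2 * (P + 1) ^ d) (h𝓜 : 𝓜.HasIntegralRewards P)
    (h𝓜' : 𝓜'.HasIntegralRewards P) (τ : Trajectory S A Z H) (δ : ℝ)
    (hδ : ∀ (t : Fin d ↪ Fin H) (o : Fin d → Option Z),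
      |𝓜.moment (pairSeq τ ∘ t) o - 𝓜'.moment (pairSeq τ ∘ t) o| ≤ δ) :
    |𝓜.rewardProb τ - 𝓜'.rewardProb τ| ≤ mixtureConst M P d *
      ((∑ m, ∏ t, 𝓜.μ m (τ t).1 (τ t).2.1 (τ t).2.2 +
        ∑ m, ∏ t, 𝓜'.μ m (τ t).1 (τ t).2.1 (τ t).2.2) * δ) := by
  classical
  have hne : Nonempty (Fin d ↪ Fin H) := ⟨Fin.castLEEmb hdH⟩
  have hδ0 : 0 ≤ δ := (abs_nonneg _).trans (hδ hne.some fun _ => none)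
  -- The contexts of both models are pooled into `2M` grid points, with weights `w` and `-w'`.
  set v : Fin M ⊕ Fin M → Fin H → ℝ := Sum.elim
    (fun m t => 𝓜.μ m (τ t).1 (τ t).2.1 (τ t).2.2)
    (fun m t => 𝓜'.μ m (τ t).1 (τ t).2.1 (τ t).2.2) with hv
  set c : Fin M ⊕ Fin M → ℝ := Sum.elim 𝓜.w (fun m => - 𝓜'.w m) with hc
  have hv0 : ∀ i t, 0 ≤ v i t := by
    rintro (m | m) t
    · exact 𝓜.μ_nonneg _ _ _ _
    · exact 𝓜'.μ_nonneg _ _ _ _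
  have hcard : Fintype.card (Fin M ⊕ Fin M) = 2 * M := by simp; ring
  have hsum : ∀ T : Finset (Fin H), ∑ i, c i * ∏ t ∈ T, v i t =
      ∑ m, 𝓜.w m * ∏ t ∈ T, 𝓜.μ m (τ t).1 (τ t).2.1 (τ t).2.2 -
      ∑ m, 𝓜'.w m * ∏ t ∈ T, 𝓜'.μ m (τ t).1 (τ t).2.1 (τ t).2.2 := by
    intro T
    rw [Fintype.sum_sum_type]
    simp [hc, hv, sub_eq_add_neg]
  have htot : ∑ i, ∏ t, v i t = ∑ m, ∏ t, 𝓜.μ m (τ t).1 (τ t).2.1 (τ t).2.2 +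
        ∑ m, ∏ t, 𝓜'.μ m (τ t).1 (τ t).2.1 (τ t).2.2 := by
    rw [Fintype.sum_sum_type]
    simp [hv]
  have hprod0 : ∀ i, 0 ≤ ∏ t, v i t := fun i => Finset.prod_nonneg fun t _ => hv0 i t
  have key := abs_sum_mul_prod_le (ι := Fin M ⊕ Fin M) P d hP (by rw [hcard]; exact hd) v (by
      rintro (m | m) t
      · exact h𝓜 _ _ _ _
      · exact h𝓜' _ _ _ _) c δ (∑ i, ∏ t, v i t) hδ0 (Finset.sum_nonneg fun i _ => hprod0 i)
    (fun i => Finset.single_le_sum (fun i _ => hprod0 i) (Finset.mem_univ i)) (by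
      intro T hT
      -- A set of fewer than `d` times is enlarged to exactly `d`, with no reward specified at the
      -- added times; this uses `d ≤ H`.
      obtain ⟨T', hTT', hT'⟩ := Finset.exists_superset_card_eq hT (by simpa using hdH)
      set t : Fin d ↪ Fin H := (T'.orderEmbOfFin hT').toEmbedding with ht
      have htr : Set.range t = T' := Finset.range_orderEmbOfFin T' hT'
      set o : Fin d → Option Z := fun j => if t j ∈ T then some (τ (t j)).2.2 else none with ho
      have hm : ∀ 𝓝 : RMMDP S A Z M, ∑ m, 𝓝.w m * ∏ t ∈ T, 𝓝.μ m (τ t).1 (τ t).2.1 (τ t).2.2 =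
          𝓝.moment (pairSeq τ ∘ t) o := by
        intro 𝓝
        refine Finset.sum_congr rfl fun m _ => ?_
        congr 1
        rw [← Finset.prod_filter_mul_prod_filter_not Finset.univ (fun j => t j ∈ T)]
        rw [Finset.prod_eq_one (s := Finset.univ.filter fun j => ¬ t j ∈ T), mul_one]
        · symm
          refine Finset.prod_bij (fun j _ => t j) (fun j hj => (Finset.mem_filter.1 hj).2)
            (fun i _ j _ hij => t.injective hij) (fun i hi => ?_) (fun j hj => ?_)
          · have : i ∈ Set.range t := by rw [htr]; exact hTT' hi
            obtain ⟨j, rfl⟩ := this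
            exact ⟨j, by simp [hi], rfl⟩
          · simp only [ho, (Finset.mem_filter.1 hj).2, if_true]
            rfl
        · intro j hj
          simp [ho, (Finset.mem_filter.1 hj).2]
      rw [hsum, hm, hm]
      exact hδ t o)
  rw [hcard, htot] at key
  have e1 := hsum Finset.univ
  rw [e1] at key
  exact key

end

section

variable {S A : Type*} [Fintype S] [Fintype A] [Nonempty S] [Nonempty A] {Z : Finset ℝ} {M H : ℕ}

/-- The largest uncertainty about a moment of order `d` that is relevant for the pairs `ξ`. -/
noncomputable def uncertainty (d : ℕ) (L : List (Trajectory S A Z H)) (ξ : Fin H → S × A) : ℝ :=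
  ⨆ t : Fin d ↪ Fin H, 1 / √((pairVisits (ξ ∘ t) L : ℝ) + 1)

/-- `uncertainty` as a function of lists. -/
noncomputable def listUncertainty (d : ℕ) (L : List (Trajectory S A Z H))
    (h : List (S × A)) : ℝ :=
  uncertainty d L fun i : Fin H => (h[(i : ℕ)]?).getD (Classical.arbitrary _)

/-- The uncertainty about the transitions out of `y`. -/
noncomputable def transErr (βT : ℝ) (L : List (Trajectory S A Z H)) (y : Option (S × A)) : ℝ :=
  4 * βT * (1 / √((transVisits y L : ℝ) + 1))

/-- The optimistic value of exploring further after the data `L`, computed in the model `𝓜`. -/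
noncomputable def explorationValue (d : ℕ) (βT : ℝ) (L : List (Trajectory S A Z H))
    (𝓜 : RMMDP S A Z M) : ℝ :=
  planVal 𝓜.kernel (transErr βT L) (listUncertainty d L) H []

theorem one_div_sqrt_add_one_le_one (n : ℕ) : 1 / √((n : ℝ) + 1) ≤ 1 := by
  rw [div_le_one (by positivity)]
  exact Real.one_le_sqrt.2 (by linarith [(Nat.cast_nonneg n : (0 : ℝ) ≤ n)])

theorem uncertainty_nonneg (d : ℕ) (L : List (Trajectory S A Z H)) (ξ : Fin H → S × A) :
    0 ≤ uncertainty d L ξ := Real.iSup_nonneg fun _ => by positivity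

theorem uncertainty_le_one (d : ℕ) (L : List (Trajectory S A Z H)) (ξ : Fin H → S × A) :
    uncertainty d L ξ ≤ 1 :=
  Real.iSup_le (fun _ => one_div_sqrt_add_one_le_one _) zero_le_one

theorem le_uncertainty {d : ℕ} (L : List (Trajectory S A Z H)) (ξ : Fin H → S × A)
    (t : Fin d ↪ Fin H) : 1 / √((pairVisits (ξ ∘ t) L : ℝ) + 1) ≤ uncertainty d L ξ :=
  le_ciSup (f := fun t : Fin d ↪ Fin H => 1 / √((pairVisits (ξ ∘ t) L : ℝ) + 1))
    (Set.finite_range _).bddAbove t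

theorem exists_uncertainty_eq {d : ℕ} (hdH : d ≤ H) (L : List (Trajectory S A Z H))
    (ξ : Fin H → S × A) :
    ∃ t : Fin d ↪ Fin H, 1 / √((pairVisits (ξ ∘ t) L : ℝ) + 1) = uncertainty d L ξ := by
  have : Nonempty (Fin d ↪ Fin H) := ⟨Fin.castLEEmb hdH⟩
  exact exists_eq_ciSup_of_finite

theorem listUncertainty_ofFn (d : ℕ) (L : List (Trajectory S A Z H)) (ξ : Fin H → S × A) :
    listUncertainty d L (List.ofFn ξ) = uncertainty d L ξ := by
  unfold listUncertainty
  congr 1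
  funext i
  simp

theorem transErr_nonneg {βT : ℝ} (hβT : 0 ≤ βT) (L : List (Trajectory S A Z H))
    (y : Option (S × A)) : 0 ≤ transErr βT L y := by
  unfold transErr; positivity

variable {P d : ℕ} {β βT : ℝ} {L : List (Trajectory S A Z H)} {𝓜 𝓜' : RMMDP S A Z M}

/-- The dynamics part of the probability of a trajectory. -/
noncomputable def dynProb (𝓜 : RMMDP S A Z M) (π : Policy S A Z) (τ : Trajectory S A Z H) : ℝ :=
  seqProb (stepKernel 𝓜.kernel π fun _ _ _ => 1) τ

theorem seqProb_stepKernel_eq (p : Option (S × A) → S → ℝ) (π : Policy S A Z)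
    (g : S → A → Z → ℝ) (τ : Trajectory S A Z H) :
    seqProb (stepKernel p π g) τ = seqProb (stepKernel p π fun _ _ _ => 1) τ *
      ∏ t, g (τ t).1 (τ t).2.1 (τ t).2.2 := by
  simp only [seqProb, stepKernel, mul_one]
  rw [← Finset.prod_mul_distrib]

theorem trajProb_eq_dyn (𝓜 : RMMDP S A Z M) (π : Policy S A Z) (τ : Trajectory S A Z H) :
    𝓜.trajProb π τ = 𝓜.dynProb π τ * 𝓜.rewardProb τ := by
  rw [trajProb_eq_sum, rewardProb, Finset.mul_sum]
  refine Finset.sum_congr rfl fun m _ => ?_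
  rw [seqProb_stepKernel_eq, dynProb]
  ring

/-- The dynamics of `𝓜` combined with the rewards of one context of any model is again a trajectory
law, so optimism bounds the expected uncertainty. This absorbs the likelihood factors of
`abs_rewardProb_sub_le`, including those of the other model. -/
theorem sum_context_uncertainty_le (hβT : 1 ≤ βT) (h : 𝓜.Consistent P d β βT L)
    (h' : 𝓜'.Consistent P d β βT L) (π : Policy S A Z) (𝓝 : RMMDP S A Z M) (m : Fin M) :
    ∑ τ : Trajectory S A Z H, 𝓜.dynProb π τ *
      ((∏ t, 𝓝.μ m (τ t).1 (τ t).2.1 (τ t).2.2) * uncertainty d L (pairSeq τ)) ≤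
      explorationValue d βT L 𝓜' := by
  have key := expVal_le_planVal (u := listUncertainty d L) (𝓝.μ_sum m) (𝓝.μ_nonneg m)
    𝓜.kernel_nonneg
    𝓜.kernel_sum 𝓜'.kernel_nonneg (transErr_nonneg (by linarith) L)
    (h.kernel_sub_le hβT h') (fun _ => uncertainty_nonneg _ _ _)
    (fun _ => uncertainty_le_one _ _ _) π H []
  rw [← sum_seqProb_mul_eq_expVal (stepKernel_nonneg 𝓜.kernel_nonneg (𝓝.μ_nonneg m))] at key
  refine le_trans (le_of_eq (Finset.sum_congr rfl fun τ _ => ?_)) key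
  rw [seqProb_stepKernel_eq, List.map_ofFn,
    show stateAction ∘ τ = pairSeq τ from rfl, listUncertainty_ofFn, dynProb]
  ring

/-- Consistent models have close values, once little remains to be explored. -/
theorem abs_value_sub_le (hP : 1 ≤ P) (hdH : d ≤ H) (hH : 0 < H)
    (hd : 2 * M * P ^ d < 2 * (P + 1) ^ d) (hZ : ∀ z ∈ Z, |z| ≤ 1) (hβ : 1 ≤ β) (hβT : 1 ≤ βT)
    (h : 𝓜.Consistent P d β βT L) (h' : 𝓜'.Consistent P d β βT L) (π : Policy S A Z) :
    |𝓜.value H π - 𝓜'.value H π| ≤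
      H * (2 + mixtureConst M P d * (4 * β) * (2 * M)) * explorationValue d βT L 𝓜' := by
  set V := explorationValue d βT L 𝓜'
  set G : Trajectory S A Z H → ℝ := fun τ => ∑ t, ((τ t).2.2 : ℝ) with hG
  have hH0 : (0 : ℝ) < H := by exact_mod_cast hH
  have hB0 : 0 ≤ mixtureConst M P d := by unfold mixtureConst; positivity
  have hGb : ∀ τ, |G τ| ≤ H := by
    intro τ
    refine (Finset.abs_sum_le_sum_abs _ _).trans ?_
    calc _ ≤ ∑ _t : Fin H, (1 : ℝ) := Finset.sum_le_sum fun t _ => hZ _ (τ t).2.2.2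
      _ = H := by simp
  have hdyn0 : ∀ τ : Trajectory S A Z H, 0 ≤ 𝓜.dynProb π τ := fun τ =>
    seqProb_nonneg (stepKernel_nonneg 𝓜.kernel_nonneg fun _ _ _ => zero_le_one) τ
  -- The hybrid with the dynamics of `𝓜` and the rewards of `𝓜'` separates the reward error from the
  -- transition error.
  have hsplit : 𝓜.value H π - 𝓜'.value H π =
      ∑ τ, 𝓜.dynProb π τ * (𝓜.rewardProb τ - 𝓜'.rewardProb τ) * G τ +
      ∑ τ, (𝓜.dynProb π τ - 𝓜'.dynProb π τ) * 𝓜'.rewardProb τ * G τ := by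
    unfold value
    rw [← Finset.sum_sub_distrib, ← Finset.sum_add_distrib]
    refine Finset.sum_congr rfl fun τ _ => ?_
    rw [trajProb_eq_dyn, trajProb_eq_dyn]
    ring
  have hfirst : |∑ τ, 𝓜.dynProb π τ * (𝓜.rewardProb τ - 𝓜'.rewardProb τ) * G τ| ≤
      H * (mixtureConst M P d * (4 * β) * (2 * M)) * V := by
    refine (Finset.abs_sum_le_sum_abs _ _).trans ?_
    calc _ ≤ ∑ τ : Trajectory S A Z H, H * (mixtureConst M P d * (4 * β)) *
          (∑ m, 𝓜.dynProb π τ * ((∏ t, 𝓜.μ m (τ t).1 (τ t).2.1 (τ t).2.2) *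
            uncertainty d L (pairSeq τ)) +
          ∑ m, 𝓜.dynProb π τ * ((∏ t, 𝓜'.μ m (τ t).1 (τ t).2.1 (τ t).2.2) *
            uncertainty d L (pairSeq τ))) := by
          refine Finset.sum_le_sum fun τ _ => ?_
          have hr := abs_rewardProb_sub_le 𝓜 𝓜' hP hdH hd h.integral h'.integral τ
            (4 * β * uncertainty d L (pairSeq τ)) (fun t o =>
              (h.moment_sub_le hβ h' _ o).trans
                (mul_le_mul_of_nonneg_left (le_uncertainty L _ t) (by linarith)))
          rw [abs_mul, abs_mul, abs_of_nonneg (hdyn0 τ)]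
          calc _ ≤ 𝓜.dynProb π τ * (mixtureConst M P d *
                ((∑ m, ∏ t, 𝓜.μ m (τ t).1 (τ t).2.1 (τ t).2.2 +
                  ∑ m, ∏ t, 𝓜'.μ m (τ t).1 (τ t).2.1 (τ t).2.2) *
                  (4 * β * uncertainty d L (pairSeq τ)))) * H :=
                mul_le_mul (mul_le_mul_of_nonneg_left hr (hdyn0 τ)) (hGb τ) (abs_nonneg _)
                  (mul_nonneg (hdyn0 τ) ((abs_nonneg _).trans hr))
            _ = _ := by
                simp_rw [← Finset.mul_sum, ← Finset.sum_mul]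
                ring
      _ = H * (mixtureConst M P d * (4 * β)) *
          (∑ m, ∑ τ : Trajectory S A Z H, 𝓜.dynProb π τ *
            ((∏ t, 𝓜.μ m (τ t).1 (τ t).2.1 (τ t).2.2) * uncertainty d L (pairSeq τ)) +
          ∑ m, ∑ τ : Trajectory S A Z H, 𝓜.dynProb π τ *
            ((∏ t, 𝓜'.μ m (τ t).1 (τ t).2.1 (τ t).2.2) * uncertainty d L (pairSeq τ))) := by
          rw [← Finset.mul_sum, Finset.sum_add_distrib, Finset.sum_comm]
          congr 2
          rw [Finset.sum_comm]
      _ ≤ H * (mixtureConst M P d * (4 * β)) * (∑ _m : Fin M, V + ∑ _m : Fin M, V) := by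
          refine mul_le_mul_of_nonneg_left (add_le_add ?_ ?_) (by positivity)
          · exact Finset.sum_le_sum fun m _ => sum_context_uncertainty_le hβT h h' π 𝓜 m
          · exact Finset.sum_le_sum fun m _ => sum_context_uncertainty_le hβT h h' π 𝓜' m
      _ = _ := by
          simp only [Finset.sum_const, Finset.card_univ, Fintype.card_fin, nsmul_eq_mul]
          ring
  have hsecond : |∑ τ, (𝓜.dynProb π τ - 𝓜'.dynProb π τ) * 𝓜'.rewardProb τ * G τ| ≤
      H * 2 * V := by
    -- The return divided by `H`, extended to lists of any length so that it is bounded by `1`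
    -- everywhere, as the simulation lemma demands.
    set F : List (S × A × Z) → ℝ := fun l =>
      (∑ i : Fin H, (l[(i : ℕ)]?).elim 0 fun a => (a.2.2 : ℝ)) / H with hF
    have hFG : ∀ τ : Trajectory S A Z H, G τ = H * F (List.ofFn τ) := by
      intro τ
      simp only [hF]
      rw [mul_div_cancel₀ _ hH0.ne']
      refine Finset.sum_congr rfl fun i _ => ?_
      simp
    have hF1 : ∀ l, |F l| ≤ 1 := by
      intro l
      simp only [hF]
      rw [abs_div, abs_of_pos hH0, div_le_one hH0]
      refine (Finset.abs_sum_le_sum_abs _ _).trans ?_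
      calc _ ≤ ∑ _t : Fin H, (1 : ℝ) := Finset.sum_le_sum fun t _ => by
            cases l[(t : ℕ)]? with
            | none => simp
            | some a => exact hZ _ a.2.2.2
        _ = H := by simp
    have hctx : ∀ m, |∑ τ : Trajectory S A Z H, seqProb (stepKernel 𝓜.kernel π (𝓜'.μ m)) τ *
        F (List.ofFn τ) - ∑ τ : Trajectory S A Z H,
          seqProb (stepKernel 𝓜'.kernel π (𝓜'.μ m)) τ * F (List.ofFn τ)| ≤ 2 * V := by
      intro m
      rw [sum_seqProb_mul_eq_expVal (stepKernel_nonneg 𝓜.kernel_nonneg (𝓜'.μ_nonneg m)),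
        sum_seqProb_mul_eq_expVal (stepKernel_nonneg 𝓜'.kernel_nonneg (𝓜'.μ_nonneg m))]
      exact abs_expVal_sub_le (𝓜'.μ_sum m) (𝓜'.μ_nonneg m) 𝓜.kernel_nonneg 𝓜.kernel_sum
        𝓜'.kernel_nonneg 𝓜'.kernel_sum (transErr_nonneg (by linarith) L)
        (h.kernel_sub_le hβT h') (fun _ => uncertainty_nonneg _ _ _) hF1 π H []
    have heq : ∑ τ, (𝓜.dynProb π τ - 𝓜'.dynProb π τ) * 𝓜'.rewardProb τ * G τ =
        H * ∑ m, 𝓜'.w m * (∑ τ : Trajectory S A Z H,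
          seqProb (stepKernel 𝓜.kernel π (𝓜'.μ m)) τ * F (List.ofFn τ) -
          ∑ τ : Trajectory S A Z H,
          seqProb (stepKernel 𝓜'.kernel π (𝓜'.μ m)) τ * F (List.ofFn τ)) := by
      have hpt : ∀ τ : Trajectory S A Z H,
          (𝓜.dynProb π τ - 𝓜'.dynProb π τ) * 𝓜'.rewardProb τ * G τ =
          ∑ m, H * (𝓜'.w m * (seqProb (stepKernel 𝓜.kernel π (𝓜'.μ m)) τ * F (List.ofFn τ) -
            seqProb (stepKernel 𝓜'.kernel π (𝓜'.μ m)) τ * F (List.ofFn τ))) := by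
        intro τ
        rw [hFG, rewardProb, Finset.mul_sum, Finset.sum_mul]
        refine Finset.sum_congr rfl fun m _ => ?_
        rw [seqProb_stepKernel_eq, seqProb_stepKernel_eq 𝓜'.kernel, dynProb, dynProb]
        ring
      rw [Finset.sum_congr rfl fun τ _ => hpt τ, Finset.sum_comm, Finset.mul_sum]
      refine Finset.sum_congr rfl fun m _ => ?_
      rw [← Finset.sum_sub_distrib, Finset.mul_sum, Finset.mul_sum]
    rw [heq, abs_mul, abs_of_pos hH0, mul_assoc]
    refine mul_le_mul_of_nonneg_left ((Finset.abs_sum_le_sum_abs _ _).trans ?_) hH0.le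
    calc _ ≤ ∑ m, 𝓜'.w m * (2 * V) := by
          refine Finset.sum_le_sum fun m _ => ?_
          rw [abs_mul, abs_of_nonneg (𝓜'.w_nonneg m)]
          exact mul_le_mul_of_nonneg_left (hctx m) (𝓜'.w_nonneg m)
      _ = 2 * V := by rw [← Finset.sum_mul, 𝓜'.w_sum, one_mul]
  rw [hsplit]
  refine (abs_add_le _ _).trans ((add_le_add hfirst hsecond).trans (le_of_eq ?_))
  ring

/-! ### The algorithm -/

open Classical in
/-- The exploration policy after the data `L`: greedy for the exploration value of some consistent
model. -/
noncomputable def explorePolicy (M P d : ℕ) (β βT : ℝ) (L : List (Trajectory S A Z H)) :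
    List (S × A) → S → A :=
  if h : ∃ 𝓜 : RMMDP S A Z M, 𝓜.Consistent P d β βT L then
    greedy h.choose.kernel (transErr βT L) (listUncertainty d L) H
  else fun _ _ => Classical.arbitrary A

/-- The policy `π` is nearly optimal for a model that is consistent with a prefix of the data after
which little remained to be explored. -/
def Acceptable (M P d : ℕ) (β βT ε₁ ε₂ : ℝ) (L : List (Trajectory S A Z H))
    (π : Policy S A Z) : Prop :=
  ∃ (k : ℕ) (𝓜 : RMMDP S A Z M), k ≤ L.length ∧ 𝓜.Consistent P d β βT (L.take k) ∧
    explorationValue d βT (L.take k) 𝓜 ≤ ε₁ ∧ 𝓜.IsEpsOptimal H ε₂ π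

open Classical in
/-- Explore with `explorePolicy`, and output any acceptable policy. -/
noncomputable def explorationAlgorithm (S A : Type*) [Fintype S] [Fintype A] [Nonempty S]
    [Nonempty A] (Z : Finset ℝ) (H M P d : ℕ) (β βT ε₁ ε₂ : ℝ) : LearningAlgorithm S A Z H where
  explore L := blind (explorePolicy M P d β βT L)
  output L := if h : ∃ π, Acceptable M P d β βT ε₁ ε₂ L π then h.choose
    else fun _ _ => Classical.arbitrary A

/-- The exploration reward of the trajectory `τ`, scaled into `[0, 1]`. -/
noncomputable def explorationReward (d : ℕ) (βT : ℝ) (L : List (Trajectory S A Z H))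
    (τ : Trajectory S A Z H) : ℝ :=
  (uncertainty d L (pairSeq τ) + 2 * ∑ t, min 1 (transErr βT L (prevPair τ t))) / (3 * H)

theorem explorationReward_nonneg (hβT : 0 ≤ βT) (d : ℕ) (L : List (Trajectory S A Z H))
    (τ : Trajectory S A Z H) : 0 ≤ explorationReward d βT L τ := by
  have h1 := uncertainty_nonneg d L (pairSeq τ)
  have h2 : 0 ≤ ∑ t, min 1 (transErr βT L (prevPair τ t)) :=
    Finset.sum_nonneg fun t _ => le_min zero_le_one (transErr_nonneg hβT L _)
  unfold explorationReward
  positivity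

theorem explorationReward_le_one (hH : 0 < H) (d : ℕ) (L : List (Trajectory S A Z H))
    (τ : Trajectory S A Z H) : explorationReward d βT L τ ≤ 1 := by
  have hH0 : (1 : ℝ) ≤ H := by exact_mod_cast hH
  have h1 := uncertainty_le_one d L (pairSeq τ)
  have h2 : ∑ t, min 1 (transErr βT L (prevPair τ t)) ≤ H := by
    calc _ ≤ ∑ _t : Fin H, (1 : ℝ) := Finset.sum_le_sum fun t _ => min_le_left _ _
      _ = H := by simp
  unfold explorationReward
  rw [div_le_one (by positivity)]
  linarith

/-- The witness is the model selected by `explorePolicy`. Its greedy guarantee holds in every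
context of the true model, hence for the mixture; `3 * H` undoes the scaling of `explorationReward`.
-/
theorem explorationValue_le (hH : 0 < H) (hβT : 1 ≤ βT) (h : 𝓜.Consistent P d β βT L) :
    ∃ 𝓜' : RMMDP S A Z M, 𝓜'.Consistent P d β βT L ∧ explorationValue d βT L 𝓜' ≤
      3 * H * ∑ τ, 𝓜.trajProb (blind (explorePolicy M P d β βT L)) τ *
        explorationReward d βT L τ := by
  have hex : ∃ 𝓜 : RMMDP S A Z M, 𝓜.Consistent P d β βT L := ⟨𝓜, h⟩
  have hH0 : (0 : ℝ) < H := by exact_mod_cast hH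
  refine ⟨hex.choose, hex.choose_spec, ?_⟩
  set 𝓜' := hex.choose
  have h' : 𝓜'.Consistent P d β βT L := hex.choose_spec
  have hpol : explorePolicy M P d β βT L =
      greedy 𝓜'.kernel (transErr βT L) (listUncertainty d L) H := dif_pos hex
  rw [hpol]
  have hm : ∀ m, explorationValue d βT L 𝓜' ≤ _ := fun m =>
    planVal_le_sum_seqProb (u := listUncertainty d L) (𝓜.μ_sum m) (𝓜.μ_nonneg m) 𝓜.kernel_nonneg
      𝓜.kernel_sum 𝓜'.kernel_nonneg (transErr_nonneg (by linarith) L)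
      (h.kernel_sub_le hβT h') (fun _ => uncertainty_nonneg _ _ _)
      (fun _ => uncertainty_le_one _ _ _) H
  calc explorationValue d βT L 𝓜' = ∑ m, 𝓜.w m * explorationValue d βT L 𝓜' := by
        rw [← Finset.sum_mul, 𝓜.w_sum, one_mul]
    _ ≤ _ := Finset.sum_le_sum fun m _ => mul_le_mul_of_nonneg_left (hm m) (𝓜.w_nonneg m)
    _ = _ := by
        set pol := blind (Z := Z)
          (greedy 𝓜'.kernel (transErr βT L) (listUncertainty d L) H)
        have hpt : ∀ τ : Trajectory S A Z H,
            3 * H * (𝓜.trajProb pol τ * explorationReward d βT L τ) =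
            ∑ m, 𝓜.w m * (seqProb (stepKernel 𝓜.kernel pol (𝓜.μ m)) τ *
              (listUncertainty d L (List.ofFn (pairSeq τ)) +
                2 * ∑ t, min 1 (transErr βT L (prevPair τ t)))) := by
          intro τ
          rw [trajProb_eq_sum, listUncertainty_ofFn, explorationReward, Finset.sum_mul,
            Finset.mul_sum]
          refine Finset.sum_congr rfl fun m _ => ?_
          field_simp
        symm
        rw [Finset.mul_sum, Finset.sum_congr rfl fun τ _ => hpt τ, Finset.sum_comm]
        refine Finset.sum_congr rfl fun m _ => ?_
        rw [Finset.mul_sum]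

end

/-! ### The exploration budget and the guarantee of the algorithm. -/

theorem sum_map_take {α : Type*} (f : α → ℕ) (L : List α) (k : ℕ) :
    ((L.take k).map f).sum = ∑ i ∈ Finset.range k, (L[i]?).elim 0 f := by
  induction k with
  | zero => simp
  | succ k ih =>
    rw [List.take_add_one, List.map_append, List.sum_append, ih, Finset.sum_range_succ]
    congr 1
    cases L[k]? <;> simp

/-- Visits counted by `f` are at least the previous occurrences of the same label. -/
theorem card_filter_le_sum_take {α γ : Type*} [DecidableEq γ] {N : ℕ} (D : Fin N → α)
    (f : α → ℕ) (y : ℕ → γ) (g : γ) (hf : ∀ j : Fin N, y j = g → 1 ≤ f (D j)) (k : ℕ)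
    (hk : k ≤ N) :
    ((Finset.range k).filter fun j => y j = g).card ≤ (((List.ofFn D).take k).map f).sum := by
  rw [sum_map_take, Finset.card_filter]
  refine Finset.sum_le_sum fun i hi => ?_
  have hi' : i < N := (Finset.mem_range.1 hi).trans_le hk
  split_ifs with h
  · have := hf ⟨i, hi'⟩ h
    simpa [hi'] using this
  · exact Nat.zero_le _

/-- The pigeonhole estimate along a sequence of data. -/
theorem sum_inv_sqrt_take_le {α γ : Type*} [Fintype γ] [Nonempty γ] {N : ℕ} (D : Fin N → α)
    (f : γ → α → ℕ) (y : Fin N → γ) (hf : ∀ j, 1 ≤ f (y j) (D j)) :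
    ∑ k : Fin N, 1 / √(((((List.ofFn D).take k).map (f (y k))).sum : ℕ) + 1 : ℝ) ≤
      2 * √(Fintype.card γ * N) := by
  classical
  set y' : ℕ → γ := fun k => if h : k < N then y ⟨k, h⟩ else Classical.arbitrary γ with hy'
  have hyy : ∀ k : Fin N, y' k = y k := fun k => by simp [hy']
  have := sum_inv_sqrt_visits_le y' N
    (fun k => (((List.ofFn D).take k).map (f (y' k))).sum) (by
      intro k hk
      refine card_filter_le_sum_take D (f (y' k)) y' (y' k) (fun j hj => ?_) k hk.le
      rw [← hj, hyy]
      exact hf j)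
  rw [Finset.sum_range] at this
  simpa only [hyy] using this

section

variable {S A : Type*} [Fintype S] [Fintype A] [Nonempty S] [Nonempty A] {Z : Finset ℝ} {M H : ℕ}
  {P d : ℕ} {β βT : ℝ}

/-- The total exploration reward grows at most like the square root of the number of episodes. -/
theorem sum_explorationReward_le (hβT : 0 ≤ βT) (hdH : d ≤ H) {N : ℕ}
    (D : Fin N → Trajectory S A Z H) :
    3 * H * ∑ k : Fin N, explorationReward d βT ((List.ofFn D).take k) (D k) ≤
      2 * √(((Fintype.card S * Fintype.card A : ℕ) : ℝ) ^ d * N) +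
        16 * βT * H * √(((Fintype.card S * Fintype.card A : ℕ) + 1 : ℝ) * N) := by
  classical
  rcases Nat.eq_zero_or_pos H with rfl | hH
  · simp only [Nat.cast_zero, mul_zero, zero_mul, add_zero]; positivity
  have hH0 : (0 : ℝ) < H := by exact_mod_cast hH
  have h1 : ∑ k : Fin N, uncertainty d ((List.ofFn D).take k) (pairSeq (D k)) ≤
      2 * √(((Fintype.card S * Fintype.card A : ℕ) : ℝ) ^ d * N) := by
    -- Each episode is labelled by a `d`-tuple attaining its uncertainty. The episode itself visits
    -- that tuple, so pigeonhole applies with `(SA) ^ d` labels.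
    choose t ht using fun k : Fin N =>
      exists_uncertainty_eq hdH ((List.ofFn D).take k) (pairSeq (D k))
    have := sum_inv_sqrt_take_le D
      (fun (x : Fin d → S × A) τ => visitCount x (pairSeq τ)) (fun k => pairSeq (D k) ∘ t k)
      (fun j => by
        have : Visits (pairSeq (D j) ∘ t j) (pairSeq (D j)) := ⟨t j, rfl⟩
        simp [visitCount, this])
    calc _ = _ := Finset.sum_congr rfl fun k _ => (ht k).symm
      _ ≤ _ := this
      _ = _ := by simp
  -- For a fixed time `i` the label is the preceding pair, or `none` at the start: `SA + 1` labels.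
  -- Visits at other times of earlier episodes only help.
  have h2 : ∀ i : Fin H, ∑ k : Fin N, transErr βT ((List.ofFn D).take k) (prevPair (D k) i) ≤
      4 * βT * (2 * √(((Fintype.card S * Fintype.card A : ℕ) + 1 : ℝ) * N)) := by
    intro i
    have := sum_inv_sqrt_take_le D transCount (fun k => prevPair (D k) i) (fun j => by
      unfold transCount
      exact Finset.card_pos.2 ⟨i, by simp⟩)
    unfold transErr
    rw [← Finset.mul_sum]
    refine mul_le_mul_of_nonneg_left (this.trans (le_of_eq ?_)) (by positivity)
    simp
  have h3 : 3 * H * ∑ k : Fin N, explorationReward d βT ((List.ofFn D).take k) (D k) =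
      ∑ k : Fin N, uncertainty d ((List.ofFn D).take k) (pairSeq (D k)) +
      2 * ∑ i : Fin H, ∑ k : Fin N, min 1 (transErr βT ((List.ofFn D).take k)
        (prevPair (D k) i)) := by
    unfold explorationReward
    rw [← Finset.sum_div, mul_div_cancel₀ _ (by positivity), Finset.sum_add_distrib,
      ← Finset.mul_sum, Finset.sum_comm]
  rw [h3]
  refine add_le_add h1 ?_
  calc _ ≤ 2 * ∑ _i : Fin H,
        4 * βT * (2 * √(((Fintype.card S * Fintype.card A : ℕ) + 1 : ℝ) * N)) := by
        gcongr with i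
        exact (Finset.sum_le_sum fun k _ => min_le_right _ _).trans (h2 i)
    _ = _ := by simp; ring

/-- Near-optimal policies exist. -/
theorem exists_isEpsOptimal (𝓜 : RMMDP S A Z M) {ε : ℝ} (hε : 0 < ε) :
    ∃ π, 𝓜.IsEpsOptimal H ε π := by
  have : Nonempty (Policy S A Z) := ⟨fun _ _ => Classical.arbitrary A⟩
  obtain ⟨π, hπ⟩ := exists_lt_of_lt_ciSup (f := fun π => 𝓜.value H π)
    (b := 𝓜.optimalValue H - ε) (by unfold optimalValue; linarith)
  exact ⟨π, hπ.le⟩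

theorem bddAbove_value (𝓜 : RMMDP S A Z M) (hZ : ∀ z ∈ Z, |z| ≤ 1) :
    BddAbove (Set.range fun π => 𝓜.value H π) := by
  refine ⟨H, ?_⟩
  rintro _ ⟨π, rfl⟩
  calc 𝓜.value H π ≤ ∑ τ : Trajectory S A Z H, 𝓜.trajProb π τ * H := by
        refine Finset.sum_le_sum fun τ _ => mul_le_mul_of_nonneg_left ?_ (𝓜.trajProb_nonneg π τ)
        calc _ ≤ ∑ _t : Fin H, (1 : ℝ) :=
              Finset.sum_le_sum fun t _ => (abs_le.1 (hZ _ (τ t).2.2.2)).2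
          _ = H := by simp
    _ = H := by rw [← Finset.sum_mul, sum_trajProb, one_mul]

/-- A near-optimal policy of a model with uniformly close values is near-optimal. -/
theorem IsEpsOptimal.of_close {𝓜 𝓜' : RMMDP S A Z M} (hZ : ∀ z ∈ Z, |z| ≤ 1) {π : Policy S A Z}
    {ε δ : ℝ} (hπ : 𝓜'.IsEpsOptimal H ε π) (hδ : ∀ π, |𝓜.value H π - 𝓜'.value H π| ≤ δ) :
    𝓜.IsEpsOptimal H (ε + 2 * δ) π := by
  have : Nonempty (Policy S A Z) := ⟨π⟩
  unfold IsEpsOptimal at hπ ⊢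
  have h1 : 𝓜.optimalValue H ≤ 𝓜'.optimalValue H + δ := by
    refine ciSup_le fun π' => ?_
    have h2 := le_ciSup (𝓜'.bddAbove_value (H := H) hZ) π'
    have h3 := (abs_le.1 (hδ π')).2
    unfold optimalValue
    linarith
  have h3 := (abs_le.1 (hδ π)).1
  linarith

/-- The guarantee of the exploration algorithm, before the choice of parameters. -/
theorem one_sub_le_successProb (𝓜 : RMMDP S A Z M) (hP : 1 ≤ P) (hdH : d ≤ H) (hH : 0 < H)
    (hd : 2 * M * P ^ d < 2 * (P + 1) ^ d) (hZ : ∀ z ∈ Z, |z| ≤ 1) (hβ : 1 ≤ β) (hβT : 1 ≤ βT)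
    (h𝓜 : 𝓜.HasIntegralRewards P) {N : ℕ} (hN : 0 < N) {ε ε₁ x : ℝ} (hε : 0 < ε)
    (hε₁ : H * (2 + mixtureConst M P d * (4 * β) * (2 * M)) * ε₁ ≤ ε / 4)
    (hx : 2 * (2 * √(((Fintype.card S * Fintype.card A : ℕ) : ℝ) ^ d * N) +
        16 * βT * H * √(((Fintype.card S * Fintype.card A : ℕ) + 1 : ℝ) * N)) + 6 * H * x ≤
        N * ε₁) :
    1 - ((Fintype.card S * Fintype.card A + 1) * 2 ^ Fintype.card S *
        (N * (N * H) * (2 * Real.exp (-(βT ^ 2 / 8)))) +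
      (Fintype.card S * Fintype.card A) ^ d * (M * (1 + P) ^ d) *
        (N * N * (2 * Real.exp (-(β ^ 2 / 8)))) + Real.exp (-x)) ≤
      (explorationAlgorithm S A Z H M P d β βT ε₁ (ε / 4)).successProb 𝓜 N ε := by
  classical
  have hH0 : (0 : ℝ) < H := by exact_mod_cast hH
  have hN0 : (0 : ℝ) < N := by exact_mod_cast hN
  set alg := explorationAlgorithm S A Z H M P d β βT ε₁ (ε / 4) with halg
  set K : List (Trajectory S A Z H) → Trajectory S A Z H → ℝ :=
    fun L => 𝓜.trajProb (blind (explorePolicy M P d β βT L)) with hKdef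
  have hK : ∀ L τ, 0 ≤ K L τ := fun L τ => 𝓜.trajProb_nonneg _ τ
  have hK1 : ∀ L, ∑ τ, K L τ = 1 := fun L => 𝓜.sum_trajProb _
  have hsucc : alg.successProb 𝓜 N ε =
      seqMeas K N fun D => 𝓜.IsEpsOptimal H ε (alg.output (List.ofFn D)) := rfl
  set φ : List (Trajectory S A Z H) → Trajectory S A Z H → ℝ := explorationReward d βT
  set bad₁ : (Fin N → Trajectory S A Z H) → Prop := fun D =>
    ∃ k ≤ N, ¬ 𝓜.Consistent P d β βT ((List.ofFn D).take k)
  set bad₂ : (Fin N → Trajectory S A Z H) → Prop := fun D =>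
    ∑ k : Fin N, φ ((List.ofFn D).take k) (D k) + x <
      (∑ k : Fin N, ∑ a, K ((List.ofFn D).take k) a * φ ((List.ofFn D).take k) a) / 2
  have hb₁ : seqMeas K N bad₁ ≤ _ :=
    𝓜.seqMeas_not_consistent_le hP h𝓜 d N (explorePolicy M P d β βT) β βT (by linarith)
      (by linarith)
  have hb₂ : seqMeas K N bad₂ ≤ _ :=
    seqMeas_predictable_sum_le hK hK1 φ (fun L τ => explorationReward_nonneg (by linarith) d L τ)
      (fun L τ => explorationReward_le_one hH d L τ) x
  rw [hsucc]
  refine le_trans ?_ (one_sub_le_seqMeas hK hK1 (F := fun D => bad₁ D ∨ bad₂ D) ?_)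
  · have := seqMeas_or_le hK bad₁ bad₂
    linarith
  rintro D - hgood
  push Not at hgood
  obtain ⟨hg₁, hg₂⟩ := hgood
  have hcons : ∀ k ≤ N, 𝓜.Consistent P d β βT ((List.ofFn D).take k) := by
    intro k hk
    by_contra hcon
    exact hg₁ ⟨k, hk, hcon⟩
  have hg₂' := not_lt.1 hg₂
  have hacc : ∃ π, Acceptable M P d β βT ε₁ (ε / 4) (List.ofFn D) π := by
    -- On the good event the exploration values sum to at most `N ε₁`, so some episode has value at
    -- most `ε₁`; a near-optimal policy of its selected model is acceptable.
    choose 𝓝 h𝓝 hval using fun k : Fin N => explorationValue_le hH hβT (hcons k k.isLt.le)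
    have hsum : ∑ k : Fin N, explorationValue d βT ((List.ofFn D).take k) (𝓝 k) ≤
        ∑ _k : Fin N, ε₁ := by
      have h1 := sum_explorationReward_le (βT := βT) (by linarith) hdH D
      calc _ ≤ ∑ k : Fin N, 3 * H * ∑ a, K ((List.ofFn D).take k) a * φ ((List.ofFn D).take k) a :=
            Finset.sum_le_sum fun k _ => hval k
        _ = 2 * (3 * H * ((∑ k : Fin N, ∑ a, K ((List.ofFn D).take k) a *
              φ ((List.ofFn D).take k) a) / 2)) := by rw [← Finset.mul_sum]; ring
        _ ≤ 2 * (3 * H * (∑ k : Fin N, φ ((List.ofFn D).take k) (D k) + x)) := by gcongr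
        _ = 2 * (3 * H * ∑ k : Fin N, φ ((List.ofFn D).take k) (D k)) + 6 * H * x := by ring
        _ ≤ N * ε₁ := by linarith
        _ = _ := by simp
    have : Nonempty (Fin N) := ⟨⟨0, hN⟩⟩
    obtain ⟨k, -, hk⟩ := Finset.exists_le_of_sum_le Finset.univ_nonempty hsum
    obtain ⟨π, hπ⟩ := (𝓝 k).exists_isEpsOptimal (H := H) (show 0 < ε / 4 by linarith)
    exact ⟨π, k, 𝓝 k, by simp [k.isLt.le], h𝓝 k, hk, hπ⟩
  have hout : alg.output (List.ofFn D) = hacc.choose := dif_pos hacc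
  rw [hout]
  -- The prefix and model behind the output may be any others: the truth is consistent with every
  -- prefix, so the comparison applies to them. The loss is `ε/4 + 2 · ε/4 ≤ ε`.
  obtain ⟨k, 𝓜', hkN, hc', hv', hπ⟩ := hacc.choose_spec
  have hclose := hπ.of_close (𝓜 := 𝓜) hZ (δ := ε / 4) (fun π => by
    refine (abs_value_sub_le hP hdH hH hd hZ hβ hβT (hcons k (by simpa using hkN)) hc' π).trans
      (le_trans ?_ hε₁)
    have hB0 : 0 ≤ mixtureConst M P d := by unfold mixtureConst; positivity
    exact mul_le_mul_of_nonneg_left hv' (by positivity))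
  unfold IsEpsOptimal at hclose ⊢
  linarith

end

/-! ### Choice of parameters and numerical estimates. -/

/-- Since `d < 2P log M + 1`, the bounds `log 2 ≤ 1` and `log 2 ≤ log M` give `2 ^ d ≤ M ^ (2P +
1)`, the last one absorbing the rounding; then `1 + P ≤ 2 ^ P`. -/
theorem one_add_pow_le_pow (P M d : ℕ) (hM : 2 ≤ M) (hd : d = ⌈2 * (P : ℝ) * Real.log M⌉₊) :
    (1 + P) ^ d ≤ M ^ ((2 * P + 1) * P) := by
  have hM0 : (0 : ℝ) < M := by positivity
  have hlog : 0 ≤ Real.log M := Real.log_natCast_nonneg M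
  have h1 : (d : ℝ) < 2 * P * Real.log M + 1 := hd ▸ Nat.ceil_lt_add_one (by positivity)
  have h2 : (2 : ℝ) ^ d ≤ M ^ (2 * P + 1) := by
    have hl2 : Real.log 2 ≤ 1 := by linarith [Real.log_two_lt_d9]
    have hl2' : Real.log 2 ≤ Real.log M := Real.log_le_log (by norm_num) (by exact_mod_cast hM)
    have hl20 : 0 ≤ Real.log 2 := Real.log_nonneg (by norm_num)
    rw [← Real.log_le_log_iff (by positivity) (by positivity), Real.log_pow, Real.log_pow]
    push_cast
    calc (d : ℝ) * Real.log 2 ≤ (2 * P * Real.log M + 1) * Real.log 2 := by gcongr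
      _ = 2 * P * Real.log M * Real.log 2 + Real.log 2 := by ring
      _ ≤ 2 * P * Real.log M * 1 + Real.log M := by gcongr
      _ = _ := by ring
  have h3 : 2 ^ d ≤ M ^ (2 * P + 1) := by exact_mod_cast h2
  calc (1 + P) ^ d ≤ (2 ^ P) ^ d := by
        gcongr
        rw [add_comm]
        exact Nat.lt_two_pow_self
    _ = (2 ^ d) ^ P := by rw [← pow_mul, ← pow_mul, mul_comm]
    _ ≤ (M ^ (2 * P + 1)) ^ P := by gcongr
    _ = _ := by rw [← pow_mul]

/-- The source of the factor `M ^ (c M)`: the factorial is at most `M ^ (4M)` because `2M ≤ M²`, and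
`P ^ d` is polynomial in `M` for fixed `P`. -/
theorem mixtureConst_mul_le (P M d : ℕ) (hM : 2 ≤ M) (hd : d = ⌈2 * (P : ℝ) * Real.log M⌉₊) :
    mixtureConst M P d * M ≤ (M : ℝ) ^ ((7 + 3 * ((2 * P + 1) * P)) * M) := by
  have hM1 : 1 ≤ M := by omega
  have h1 := one_add_pow_le_pow P M d hM hd
  have h2 : P ^ (d * (2 * M + 1)) ≤ M ^ ((2 * P + 1) * P * (3 * M)) := by
    rw [pow_mul, pow_mul M]
    calc (P ^ d) ^ (2 * M + 1) ≤ (M ^ ((2 * P + 1) * P)) ^ (2 * M + 1) :=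
          Nat.pow_le_pow_left (le_trans (Nat.pow_le_pow_left (by omega) d) h1) _
      _ ≤ _ := by
          apply Nat.pow_le_pow_right
          · positivity
          · omega
  have h3 : (2 * M).factorial ≤ M ^ (4 * M) := by
    calc (2 * M).factorial ≤ (2 * M) ^ (2 * M) := Nat.factorial_le_pow _
      _ ≤ (M ^ 2) ^ (2 * M) := by gcongr; nlinarith
      _ = _ := by rw [← pow_mul]; congr 1; ring
  have h4 : 2 * M * (2 * M).factorial * P ^ (d * (2 * M + 1)) * M ≤
      M ^ ((7 + 3 * ((2 * P + 1) * P)) * M) := by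
    calc _ ≤ M ^ 2 * M ^ (4 * M) * M ^ ((2 * P + 1) * P * (3 * M)) * M := by
          gcongr; nlinarith
      _ = M ^ (3 + 4 * M + (2 * P + 1) * P * (3 * M)) := by ring
      _ ≤ _ := by
          apply Nat.pow_le_pow_right hM1
          nlinarith
  unfold mixtureConst
  exact_mod_cast h4

theorem one_le_mixtureConst (P M d : ℕ) (hP : 1 ≤ P) (hM : 1 ≤ M) : 1 ≤ mixtureConst M P d := by
  have : 1 ≤ 2 * M * (2 * M).factorial * P ^ (d * (2 * M + 1)) :=
    Nat.succ_le_of_lt (by positivity)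
  unfold mixtureConst
  exact_mod_cast this

/-- The failure probability of the exploration algorithm for the chosen parameters. -/
theorem failure_le {s X K H L η Y : ℝ} (n : ℕ) (hn : s = n) (hn1 : 1 ≤ n) (hX : 1 ≤ X)
    (hXK : X ≤ K) (hH : 0 ≤ H) (hHK : H ≤ K) (hK : 1 ≤ K) (hη0 : 0 < η) (hη1 : η < 1)
    (hL : L = 1 + Real.log (K / η)) (hL1 : 1 ≤ L) {Xd : ℝ} (hXd : Xd ≤ K)
    (hY0 : 0 ≤ Y) (hY : Y ≤ K) :
    (X + 1) * 2 ^ n * (K * (K * H) * (2 * Real.exp (-((8 * √(s * L)) ^ 2 / 8)))) +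
      Xd * Y * (K * K * (2 * Real.exp (-((8 * √L) ^ 2 / 8)))) + Real.exp (-(2 * L)) ≤ η := by
  have hK0 : 0 < K := by linarith
  have hs1 : 1 ≤ s := by rw [hn]; exact_mod_cast hn1
  -- `ρ = η / (e K)`, so powers of `ρ` cancel the polynomial factors in `K` of the union bounds and
  -- leave a multiple of `η`.
  set ρ := Real.exp (-L) with hρ
  have hρ0 : 0 < ρ := Real.exp_pos _
  have hρK : ρ * K ≤ η / 2 := by
    have h1 : ρ = Real.exp (-1) * (η / K) := by
      rw [hρ, hL, neg_add, Real.exp_add, Real.exp_neg (Real.log _), Real.exp_log (by positivity),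
        inv_div]
    have h2 : Real.exp (-1) ≤ 1 / 2 := by
      rw [Real.exp_neg, inv_le_comm₀ (Real.exp_pos _) (by norm_num)]
      have := Real.add_one_le_exp (1 : ℝ)
      linarith
    rw [h1, mul_assoc, div_mul_cancel₀ _ hK0.ne']
    nlinarith
  have hρ1 : ρ ≤ η / 2 := le_trans (le_mul_of_one_le_right hρ0.le hK) hρK
  have hpow : ∀ m : ℕ, ρ ^ m = Real.exp (-(m * L)) := by
    intro m
    rw [hρ, ← Real.exp_nat_mul]; congr 1; ring
  -- The extra factor `s` in the transition radius pays for the `2 ^ n` sign patterns: `8 s L - s ≥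
  -- 7 L`.
  have e1 : Real.exp (-((8 * √(s * L)) ^ 2 / 8)) * 2 ^ n ≤ ρ ^ 7 := by
    have h2 : (2 : ℝ) ^ n ≤ Real.exp s := by
      have := Real.add_one_le_exp (1 : ℝ)
      calc (2 : ℝ) ^ n ≤ Real.exp 1 ^ n := by gcongr; linarith
        _ = Real.exp s := by rw [← Real.exp_nat_mul, hn, mul_one]
    rw [mul_pow, Real.sq_sqrt (by positivity), hpow]
    calc _ ≤ Real.exp (-(8 ^ 2 * (s * L) / 8)) * Real.exp s := by gcongr
      _ = Real.exp (-(8 ^ 2 * (s * L) / 8) + s) := by rw [Real.exp_add]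
      _ ≤ _ := by
        rw [Real.exp_le_exp]
        push_cast
        nlinarith
  have e2 : Real.exp (-((8 * √L) ^ 2 / 8)) = ρ ^ 8 := by
    rw [mul_pow, Real.sq_sqrt (by linarith), hpow]
    congr 1; push_cast; ring
  have e3 : Real.exp (-(2 * L)) = ρ ^ 2 := by rw [hpow]; norm_num
  have hη2 : η / 2 ≤ 1 / 2 := by linarith
  have hr0 : 0 ≤ ρ * K := by positivity
  have hr1 : ρ * K ≤ 1 / 2 := by linarith
  have hρ2 : ρ ≤ 1 / 2 := by linarith
  have hk4 : (ρ * K) ^ 4 ≤ η / 16 := by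
    calc (ρ * K) ^ 4 = (ρ * K) ^ 3 * (ρ * K) := by ring
      _ ≤ (1 / 2) ^ 3 * (η / 2) := by gcongr
      _ = _ := by ring
  have f1 : (X + 1) * 2 ^ n * (K * (K * H) * (2 * Real.exp (-((8 * √(s * L)) ^ 2 / 8)))) ≤
      η / 4 := by
    calc _ = (X + 1) * (K * (K * H)) * 2 * (Real.exp (-((8 * √(s * L)) ^ 2 / 8)) * 2 ^ n) := by
          ring
      _ ≤ (K + K) * (K * (K * K)) * 2 * ρ ^ 7 := by gcongr
      _ = 4 * (ρ * K) ^ 4 * ρ ^ 3 := by ring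
      _ ≤ 4 * (η / 16) * (1 / 2) ^ 3 := by gcongr
      _ ≤ _ := by linarith
  have f2 : Xd * Y * (K * K * (2 * Real.exp (-((8 * √L) ^ 2 / 8)))) ≤ η / 4 := by
    rw [e2]
    calc _ ≤ K * K * (K * K * (2 * ρ ^ 8)) := by gcongr
      _ = 2 * (ρ * K) ^ 4 * ρ ^ 4 := by ring
      _ ≤ 2 * (η / 16) * (1 / 2) ^ 4 := by gcongr
      _ ≤ _ := by linarith
  have f3 : Real.exp (-(2 * L)) ≤ η / 4 := by
    rw [e3]
    calc ρ ^ 2 = ρ * ρ := by ring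
      _ ≤ (1 / 2) * (η / 2) := by gcongr
      _ = _ := by ring
  linarith

/-- The exploration budget suffices for the chosen parameters. -/
theorem budget_le {s X Xd K H L ε B M : ℝ} (hs1 : 1 ≤ s) (hsX : s ≤ X)
    (hXd : X ^ 2 ≤ Xd) (hH : 1 ≤ H) (hK : 1 ≤ K) (hε0 : 0 < ε) (hL1 : 1 ≤ L) (hLK : L ≤ K)
    (hB : 1 ≤ B) (hM : 1 ≤ M)
    (hbig : 10 ^ 11 * (Xd / ε ^ 2) * (B * M) ^ 2 * H ^ 4 * L ^ 2 ≤ K) :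
    2 * (2 * √(Xd * K) + 16 * (8 * √(s * L)) * H * √((X + 1) * K)) + 6 * H * (2 * L) ≤
      K * (ε / (4 * H * (2 + B * (4 * (8 * √L)) * (2 * M)))) := by
  have hX1 : 1 ≤ X := hs1.trans hsX
  have hXd1 : 1 ≤ Xd := le_trans (one_le_pow₀ hX1) hXd
  set R := √(Xd * K) with hR
  set l := √L with hl
  have hl1 : 1 ≤ l := Real.one_le_sqrt.2 hL1
  have hll : l * l = L := Real.mul_self_sqrt (by linarith)
  have hRR : R * R = Xd * K := Real.mul_self_sqrt (by positivity)
  have hlR : l ≤ R := Real.sqrt_le_sqrt (by nlinarith)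
  have hR0 : 0 < R := by linarith
  have h1 : √(s * L) * √((X + 1) * K) ≤ 2 * (l * R) := by
    rw [← Real.sqrt_mul (by positivity), hl, hR, ← Real.sqrt_mul (by linarith)]
    rw [Real.sqrt_le_left (by positivity), mul_pow, Real.sq_sqrt (by positivity)]
    -- Here `X ^ 2 ≤ Xd` makes the cost of learning the transitions subordinate to that of the
    -- moments.
    have : s * (X + 1) ≤ 4 * Xd := by nlinarith
    calc s * L * ((X + 1) * K) = s * (X + 1) * (L * K) := by ring
      _ ≤ 4 * Xd * (L * K) := by gcongr
      _ = _ := by ring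
  have hLHS : 2 * (2 * R + 16 * (8 * √(s * L)) * H * √((X + 1) * K)) + 6 * H * (2 * L) ≤
      528 * H * l * R := by
    have h2 : 256 * H * (√(s * L) * √((X + 1) * K)) ≤ 256 * H * (2 * (l * R)) := by gcongr
    have h3 : H * L ≤ H * (l * R) := by
      rw [← hll]; gcongr
    have h4 : R ≤ H * (l * R) := by
      have : 1 ≤ H * l := by nlinarith
      nlinarith
    nlinarith
  refine hLHS.trans ?_
  set W := 2 + B * (4 * (8 * l)) * (2 * M) with hW
  have hBM : 1 ≤ B * M := by nlinarith
  have hW0 : 0 < W := by rw [hW]; positivity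
  have hWle : W ≤ 66 * (B * M * l) := by
    have : 1 ≤ B * M * l := by nlinarith
    rw [hW]; nlinarith
  rw [← mul_div_assoc, le_div_iff₀ (by positivity)]
  -- `2112 = 4 · 528`, and `66 = 2 + 64` comes from the bound on `W`; the square of their product is
  -- below `10 ^ 11`.
  have hsq : (2112 * 66 * H ^ 2 * (B * M) * L * R) ^ 2 ≤ (K * ε) ^ 2 := by
    have e : (10 : ℝ) ^ 11 * (Xd / ε ^ 2) * (B * M) ^ 2 * H ^ 4 * L ^ 2 =
        (10 ^ 11 * Xd * (B * M) ^ 2 * H ^ 4 * L ^ 2) / ε ^ 2 := by ring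
    rw [e, div_le_iff₀ (by positivity)] at hbig
    calc (2112 * 66 * H ^ 2 * (B * M) * L * R) ^ 2
        = (2112 * 66) ^ 2 * Xd * (B * M) ^ 2 * H ^ 4 * L ^ 2 * K := by
          rw [show (2112 * 66 * H ^ 2 * (B * M) * L * R) ^ 2 =
            (2112 * 66) ^ 2 * H ^ 4 * (B * M) ^ 2 * L ^ 2 * (R * R) by ring, hRR]
          ring
      _ ≤ 10 ^ 11 * Xd * (B * M) ^ 2 * H ^ 4 * L ^ 2 * K := by
          gcongr; norm_num
      _ ≤ K * ε ^ 2 * K := by gcongr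
      _ = _ := by ring
  have hle := le_of_sq_le_sq hsq (by positivity)
  calc 528 * H * l * R * (4 * H * W) = 2112 * H ^ 2 * l * R * W := by ring
    _ ≤ 2112 * H ^ 2 * l * R * (66 * (B * M * l)) := by gcongr
    _ = 2112 * 66 * H ^ 2 * (B * M) * (l * l) * R := by ring
    _ = 2112 * 66 * H ^ 2 * (B * M) * L * R := by rw [hll]
    _ ≤ K * ε := hle

end RMMDP

theorem mainTheorem5 :
    ∃ C : ℝ, 0 < C ∧
      ∀ P : ℕ, 1 ≤ P →
        ∃ c a b : ℕ,
          ∀ (S A : Type*) [Fintype S] [Fintype A] [Nonempty S] [Nonempty A]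
            (Z : Finset ℝ) (_ : ∀ z ∈ Z, |z| ≤ 1)
            (M H : ℕ) (_ : 2 ≤ M) (_ : 2 * (P : ℝ) * Real.log M < H)
            (ε η : ℝ) (_ : 0 < ε) (_ : ε < 1) (_ : 0 < η) (_ : η < 1) (K : ℕ)
            (_ : C * (((Fintype.card S : ℝ) * (Fintype.card A : ℝ)) ^ ⌈2 * (P : ℝ) * Real.log M⌉₊
                  / ε ^ 2) * (M : ℝ) ^ (c * M) * (H : ℝ) ^ a
                  * (1 + Real.log ((K : ℝ) / η)) ^ b ≤ (K : ℝ)),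
            ∃ N : ℕ, N ≤ K ∧ ∃ alg : RMMDP.LearningAlgorithm S A Z H,
              ∀ 𝓜 : RMMDP S A Z M, 𝓜.HasIntegralRewards P →
                1 - η ≤ alg.successProb 𝓜 N ε := by
  -- The budget inequality is squared, which doubles the exponent of the mixture constant and turns
  -- the factors `H ^ 2` and `L` into `H ^ 4` and `L ^ 2`.
  refine ⟨10 ^ 11, by norm_num, fun P hP => ⟨2 * (7 + 3 * ((2 * P + 1) * P)), 4, 2, ?_⟩⟩
  intro S A _ _ _ _ Z hZ M H hM hHM ε η hε0 hε1 hη0 hη1 K hK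
  set d := ⌈2 * (P : ℝ) * Real.log M⌉₊ with hd
  set L := 1 + Real.log ((K : ℝ) / η) with hL
  set X : ℝ := (Fintype.card S : ℝ) * (Fintype.card A : ℝ) with hX
  have hP1 : (1 : ℝ) ≤ P := by exact_mod_cast hP
  have hlogM : Real.log 2 ≤ Real.log M := Real.log_le_log (by norm_num) (by exact_mod_cast hM)
  have hl2 := Real.log_two_gt_d9
  -- `2P log M ≥ 2 log 2 > 1`, so the ceiling is at least `2`.
  have hd2 : 2 ≤ d := by
    rw [hd, Nat.succ_le_iff, Nat.lt_ceil]
    push_cast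
    nlinarith
  have hdH : d ≤ H := Nat.ceil_le.2 hHM.le
  have hH0 : 0 < H := by omega
  have hH1 : (1 : ℝ) ≤ H := by exact_mod_cast hH0
  have hM1 : (1 : ℝ) ≤ M := by exact_mod_cast (by omega : 1 ≤ M)
  have hs1 : (1 : ℝ) ≤ Fintype.card S := by exact_mod_cast Fintype.card_pos (α := S)
  have ha1 : (1 : ℝ) ≤ Fintype.card A := by exact_mod_cast Fintype.card_pos (α := A)
  have hsX : (Fintype.card S : ℝ) ≤ X := le_mul_of_one_le_right (by linarith) ha1
  have hX1 : 1 ≤ X := hs1.trans hsX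
  have hXd : X ^ 2 ≤ X ^ d := pow_le_pow_right₀ hX1 hd2
  have hXX : X ≤ X ^ d := le_self_pow₀ hX1 (by omega)
  have hXd1 : 1 ≤ X ^ d := hX1.trans hXX
  have hK1 : (1 : ℝ) ≤ K := by
    rcases Nat.eq_zero_or_pos K with h0 | h0
    -- With `log 0 = 0` the logarithmic factor is `1`, so the left side stays positive and `K = 0`
    -- is impossible.
    · exfalso
      rw [hL, h0] at hK
      simp only [Nat.cast_zero, zero_div, Real.log_zero, add_zero, one_pow, mul_one] at hK
      have : 0 < (10 : ℝ) ^ 11 * (X ^ d / ε ^ 2) *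
          (M : ℝ) ^ (2 * (7 + 3 * ((2 * P + 1) * P)) * M) * (H : ℝ) ^ 4 := by positivity
      linarith
    · exact_mod_cast h0
  have hL1 : 1 ≤ L := by
    have : 0 ≤ Real.log ((K : ℝ) / η) := Real.log_nonneg (by
      rw [le_div_iff₀ hη0]; linarith)
    linarith
  set B := RMMDP.mixtureConst M P d with hB
  have hB1 : 1 ≤ B := RMMDP.one_le_mixtureConst P M d hP (by omega)
  set Q : ℝ := (M : ℝ) ^ (2 * (7 + 3 * ((2 * P + 1) * P)) * M) with hQ
  have hBQ : (B * M) ^ 2 ≤ Q := by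
    rw [hQ, mul_assoc, mul_comm 2, pow_mul]
    exact pow_le_pow_left₀ (by positivity) (RMMDP.mixtureConst_mul_le P M d hM hd) 2
  have hYQ : (M : ℝ) * (1 + P) ^ d ≤ Q := by
    have h1 := RMMDP.one_add_pow_le_pow P M d hM hd
    have h2 : M * (1 + P) ^ d ≤ M ^ (2 * (7 + 3 * ((2 * P + 1) * P)) * M) := by
      calc M * (1 + P) ^ d ≤ M * M ^ ((2 * P + 1) * P) := by gcongr
        _ = M ^ ((2 * P + 1) * P + 1) := by ring
        _ ≤ _ := by
          apply Nat.pow_le_pow_right (by omega)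
          calc (2 * P + 1) * P + 1 ≤ 2 * (7 + 3 * ((2 * P + 1) * P)) * 1 := by omega
            _ ≤ _ := by gcongr; omega
    rw [hQ]
    exact_mod_cast h2
  have hQ1 : 1 ≤ Q := one_le_pow₀ hM1
  have hXe : X ^ d ≤ X ^ d / ε ^ 2 := by
    rw [le_div_iff₀ (by positivity)]
    exact mul_le_of_le_one_right (by positivity) (pow_le_one₀ hε0.le hε1.le)
  have hlarge : X ^ d * Q * (H : ℝ) ^ 4 * L ^ 2 ≤ K := by
    refine le_trans ?_ hK
    have : X ^ d ≤ 10 ^ 11 * (X ^ d / ε ^ 2) := by linarith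
    gcongr
  have hQ0 : 0 ≤ Q := by linarith
  have hH4 : (1 : ℝ) ≤ (H : ℝ) ^ 4 := one_le_pow₀ hH1
  have hL2 : 1 ≤ L ^ 2 := one_le_pow₀ hL1
  have hXdK : X ^ d ≤ K := by
    calc X ^ d = X ^ d * 1 * 1 * 1 := by ring
      _ ≤ X ^ d * Q * (H : ℝ) ^ 4 * L ^ 2 := by gcongr
      _ ≤ K := hlarge
  have hQK : Q ≤ K := by
    calc Q = 1 * Q * 1 * 1 := by ring
      _ ≤ X ^ d * Q * (H : ℝ) ^ 4 * L ^ 2 := by gcongr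
      _ ≤ K := hlarge
  have hHK : (H : ℝ) ≤ K := by
    calc (H : ℝ) ≤ (H : ℝ) ^ 4 := le_self_pow₀ hH1 (by norm_num)
      _ = 1 * 1 * (H : ℝ) ^ 4 * 1 := by ring
      _ ≤ X ^ d * Q * (H : ℝ) ^ 4 * L ^ 2 := by gcongr
      _ ≤ K := hlarge
  have hLK : L ≤ K := by
    calc L ≤ L ^ 2 := le_self_pow₀ hL1 (by norm_num)
      _ = 1 * 1 * 1 * L ^ 2 := by ring
      _ ≤ X ^ d * Q * (H : ℝ) ^ 4 * L ^ 2 := by gcongr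
      _ ≤ K := hlarge
  have hbig : 10 ^ 11 * (X ^ d / ε ^ 2) * (B * M) ^ 2 * (H : ℝ) ^ 4 * L ^ 2 ≤ K := by
    refine le_trans ?_ hK
    gcongr
  have hbudget := RMMDP.budget_le hs1 hsX hXd hH1 hK1 hε0 hL1 hLK hB1 hM1 hbig
  have hβ : 1 ≤ 8 * √L := by
    have : 1 ≤ √L := Real.one_le_sqrt.2 hL1
    linarith
  have hβT : 1 ≤ 8 * √(Fintype.card S * L) := by
    have : 1 ≤ √(Fintype.card S * L) := Real.one_le_sqrt.2 (by nlinarith)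
    linarith
  -- All `K` episodes are used. The exploration threshold is chosen so that the comparison of values
  -- costs exactly `ε / 4`.
  refine ⟨K, le_rfl, RMMDP.explorationAlgorithm S A Z H M P d (8 * √L)
    (8 * √(Fintype.card S * L)) (ε / (4 * H * (2 + B * (4 * (8 * √L)) * (2 * M)))) (ε / 4), ?_⟩
  intro 𝓜 h𝓜
  have key := 𝓜.one_sub_le_successProb (N := K) (x := 2 * L) hP hdH hH0
    (two_mul_card_mul_pow_lt P M d hP hM (Nat.le_ceil _)) hZ hβ hβT h𝓜 (by exact_mod_cast hK1)
    hε0 (ε₁ := ε / (4 * H * (2 + B * (4 * (8 * √L)) * (2 * M)))) (by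
      have hpos : 0 < 2 + B * (4 * (8 * √L)) * (2 * M) := by positivity
      rw [← hB]
      apply le_of_eq
      field_simp) (by
      push_cast
      exact hbudget)
  refine le_trans ?_ key
  have hfail := RMMDP.failure_le (Fintype.card S) rfl Fintype.card_pos hX1 (hXX.trans hXdK)
    (by linarith) hHK hK1 hη0 hη1 hL hL1 hXdK
    (by positivity) (hYQ.trans hQK)
  linarith
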